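/- **Setting.** Let $n\ge 1$, $\kappa\ge 1$. A jet polynomial is an element of $\mathbb C[j^\kappa f]=\mathbb C[f_i^{(\lambda)}:1\le i\le n,\ 1\le\lambda\le\kappa]$. For $m\ge0$ let $\mathsf{UE}^n_{\kappa,m}$ be the space of *bi-invariants of weight $m$*: jet polynomials $\mathsf P$ such that $\mathsf P(j^\kappa(f\circ\phi))=(\phi')^m\,\mathsf P((j^\kappa f)\circ\phi)$ for all germs of holomorphic maps $f:(\mathbb C,0)\to\mathbb C^n$ and all germs of biholomorphisms $\phi$ of $(\mathbb C,0)$, and such that $\mathsf P(\mathsf u\cdot j^\kappa f)=\mathsf P(j^\kappa f)$ for every lower triangular matrix $\mathsf u$ with ones on the diagonal, acting by $f_i^{(\lambda)}\mapsto\sum_j u_{ij}f_j^{(\lambda)}$ for every $\lambda$. Put $\mathsf{UE}^n_\kappa=\bigoplus_{m\ge0}\mathsf{UE}^n_{\kappa,m}$ (the constants having weight $0$). Write $|_0$ for the substitution $f_1'=0$, and for $\Lambda_1,\dots,\Lambda_M$ let $\mathrm{Rel}(\Lambda_1|_0,\dots,\Lambda_M|_0)\subset\mathbb C[A_1,\dots,A_M]$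 be the ideal of polynomials vanishing after $A_j\mapsto\Lambda_j|_0$. A family is *mutually independent* if none of its members is a polynomial in the others. Reduced Gröbner bases are not required to have leading coefficients $1$. **The algorithm.** Let $\mathsf D$ be the total derivative ($\mathsf Df_i^{(\lambda)}=f_i^{(\lambda+1)}$) and, for $\mathsf P,\mathsf Q$ of weights $p,q$, let $[\mathsf P,\mathsf Q]=q\,\mathsf D\mathsf P\cdot\mathsf Q-p\,\mathsf P\cdot\mathsf D\mathsf Q$. For $2\le i\le n$ put $\Lambda_{1,i}^{3}=[f_i',f_1']$ and $\Lambda_{1,i}^{2\lambda-1}=[\Lambda_{1,i}^{2\lambda-3},f_1']$ for $3\le\lambda\le\kappa$. The *initial list* consists of the quotients, by the maximal power of $f_1'$ dividing them, of all minors $\det(\Lambda_{1,i}^{2\lambda_j-1})_{2\le i,j\le n_1}$ with $2\le n_1\le n$ and $2\le\lambda_2<\dots<\lambda_{n_1}\le\kappa$. One *loop*, applied to a list $\Lambda_1,\dots,\Lambda_M$ of weights $\ell_1,\dots,\ell_M$, chooses a monomial order and a reduced Gröbner basis $(\mathsf S_i)$ of $\mathrm{Rel}(\Lambda_1|_0,\dots,\Lambda_M|_0)$,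 weighted homogeneous of weights $\mu_i$ ($A_j$ having weight $\ell_j$); for every $i$ with $\mathsf S_i(\Lambda)\neq0$ it writes $\mathsf S_i(\Lambda)=(f_1')^{\nu_i}\mathsf R_i$ with $\nu_i$ maximal; and it appends to the list some of these $\mathsf R_i$ (with weights $\mu_i-\nu_i$), each of them not a polynomial in $f_1'$, the $\Lambda_j$ and the previously appended ones, such that all the $\mathsf R_i$ become polynomials in $f_1'$, the $\Lambda_j$ and the appended ones. Between loops the list may be renumbered, and members that are polynomials in $f_1'$ and the remaining members may be deleted. **Theorem.** Suppose that finitely many loops of the algorithm have produced a list $\Lambda^{\ell_1},\dots,\Lambda^{\ell_M}$ with $\Lambda^{\ell_j}\in\mathsf{UE}^n_{\kappa,\ell_j}$ such that $f_1',\Lambda^{\ell_1},\dots,\Lambda^{\ell_M}$ are mutually independent. Let $\mathsf S_1,\dots,\mathsf S_N$, weighted homogeneous of weights $\mu_1,\dots,\mu_N$, be a reduced Gröbner basis, for some monomial order, of $\mathrm{Rel}(\Lambda^{\ell_1}|_0,\dots,\Lambda^{\ell_M}|_0)$, and suppose that there are polynomials $\mathsf R_i\in\mathbb C[F,A_1,\dots,A_M]$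 with $$\mathsf S_i(\Lambda^{\ell_1},\dots,\Lambda^{\ell_M})=f_1'\,\mathsf R_i(f_1',\Lambda^{\ell_1},\dots,\Lambda^{\ell_M})\qquad(1\le i\le N).$$ Then: 1. The algorithm terminates: no loop applied to $\Lambda^{\ell_1},\dots,\Lambda^{\ell_M}$ (for whatever choice of monomial order and reduced Gröbner basis) appends a new bi-invariant. 2. $\mathsf{UE}^n_\kappa=\mathbb C[f_1',\Lambda^{\ell_1},\dots,\Lambda^{\ell_M}]$ modulo syzygies: $\mathsf{UE}^n_\kappa$ is generated as an algebra by $f_1',\Lambda^{\ell_1},\dots,\Lambda^{\ell_M}$; the $\mathsf R_i$ can be chosen such that each $F\,\mathsf R_i$ is weighted homogeneous of weight $\mu_i$ ($F$ having weight $1$ and $A_j$ weight $\ell_j$); and for every such choice the ideal of all polynomial relations between $f_1',\Lambda^{\ell_1},\dots,\Lambda^{\ell_M}$ is generated by the $N$ polynomials $\mathsf S_i(A)-F\,\mathsf R_i(F,A)$. 3. Let $\alpha^i\in\mathbb N^M$ be the exponent of the leading monomial of $\mathsf S_i$ and $\square_i=\alpha^i+\mathbb N^M$. For every $m\ge0$,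 every $\mathsf P\in\mathsf{UE}^n_{\kappa,m}$ can be written in exactly one way as $$\mathsf P=\sum_{0\le a\le m}(f_1')^a\,\widetilde{\mathsf P}_a(\Lambda^{\ell_1},\dots,\Lambda^{\ell_M}),\qquad \widetilde{\mathsf P}_a=\sum_{\substack{b\in\mathbb N^M\setminus(\square_1\cup\dots\cup\square_N)\\ \ell_1b_1+\dots+\ell_Mb_M=m-a}}c_{a;b}\,A_1^{b_1}\cdots A_M^{b_M},\quad c_{a;b}\in\mathbb C,$$ and, conversely, for all choices of the complex coefficients $c_{a;b}$ such a sum belongs to $\mathsf{UE}^n_{\kappa,m}$. -/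

import Mathlib

noncomputable section

namespace BiInvariant

open MvPolynomial

/-- Polynomials in jet variables of all orders: the variable `(i, l)` stands for the derivative
`f_{i+1}^{(l)}` of order `l` of the component number `i + 1` of `f = (f_1, …, f_n)`. -/
abbrev JetRing (n : ℕ) : Type := MvPolynomial (Fin n × ℕ) ℂ

/-- The ring `ℂ[j^κ f]` of polynomials in the variables `f_i^{(l)}` with `1 ≤ l ≤ κ`. -/
def jetPolynomials (n κ : ℕ) : Subalgebra ℂ (JetRing n) :=
  supported ℂ {p : Fin n × ℕ | 1 ≤ p.2 ∧ p.2 ≤ κ}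

/-- The jet at the origin of a map `f : ℂ → ℂⁿ`. -/
def jetAt {n : ℕ} (f : Fin n → ℂ → ℂ) : Fin n × ℕ → ℂ :=
  fun p => iteratedDeriv p.2 (f p.1) 0

/-- The space `E_{κ,m}^n` of jet polynomials invariant by reparametrization, of weight `m`:
`P(j^κ(f ∘ φ)) = (φ')^m · P((j^κ f) ∘ φ)` at the origin for all germs of holomorphic maps `f` and
all germs of biholomorphisms `φ` fixing the origin. -/
def reparamInvariants (n κ m : ℕ) : Submodule ℂ (JetRing n) where
  carrier := {P | P ∈ jetPolynomials n κ ∧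
    ∀ (f : Fin n → ℂ → ℂ) (φ : ℂ → ℂ), (∀ i, AnalyticAt ℂ (f i) 0) → AnalyticAt ℂ φ 0 →
      φ 0 = 0 → deriv φ 0 ≠ 0 →
      eval (jetAt fun i => f i ∘ φ) P = (deriv φ 0) ^ m * eval (jetAt f) P}
  add_mem' := by
    rintro P Q ⟨hP, hP'⟩ ⟨hQ, hQ'⟩
    refine ⟨add_mem hP hQ, fun f φ hf hφ h0 h1 => ?_⟩
    rw [map_add, map_add, hP' f φ hf hφ h0 h1, hQ' f φ hf hφ h0 h1, mul_add]
  zero_mem' := ⟨zero_mem _, fun f φ _ _ _ _ => by simp⟩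
  smul_mem' := by
    rintro c P ⟨hP, hP'⟩
    refine ⟨Subalgebra.smul_mem _ hP c, fun f φ hf hφ h0 h1 => ?_⟩
    rw [smul_eval, smul_eval, hP' f φ hf hφ h0 h1, mul_left_comm]

/-- Lower triangular matrices with ones on the diagonal. -/
def IsUnipotent {n : ℕ} (u : Matrix (Fin n) (Fin n) ℂ) : Prop :=
  (∀ i, u i i = 1) ∧ ∀ i j, i < j → u i j = 0

/-- A matrix acts on jet polynomials through `f_i^{(l)} ↦ ∑_j w_{ij} f_j^{(l)}`, with the same
matrix at every jet level `l`. -/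
def matrixAction {n : ℕ} (w : Matrix (Fin n) (Fin n) ℂ) : JetRing n →ₐ[ℂ] JetRing n :=
  aeval fun p => ∑ j, C (w p.1 j) * X (j, p.2)

/-- Jet polynomials invariant under the unipotent group. -/
def unipotentInvariants (n : ℕ) : Subalgebra ℂ (JetRing n) where
  carrier := {P | ∀ u : Matrix (Fin n) (Fin n) ℂ, IsUnipotent u → matrixAction u P = P}
  mul_mem' := fun hP hQ u hu => by rw [map_mul, hP u hu, hQ u hu]
  add_mem' := fun hP hQ u hu => by rw [map_add, hP u hu, hQ u hu]
  algebraMap_mem' := fun c u _ => (matrixAction u).commutes c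

/-- The space `UE_{κ,m}^n` of bi-invariants of weight `m`. -/
def UEwt (n κ m : ℕ) : Submodule ℂ (JetRing n) :=
  reparamInvariants n κ m ⊓ Subalgebra.toSubmodule (unipotentInvariants n)

theorem UEwt_mul_le (n κ a b : ℕ) : UEwt n κ a * UEwt n κ b ≤ UEwt n κ (a + b) := by
  rw [Submodule.mul_le]
  rintro P ⟨⟨hP, hP'⟩, hPu⟩ Q ⟨⟨hQ, hQ'⟩, hQu⟩
  refine ⟨⟨mul_mem hP hQ, fun f φ hf hφ h0 h1 => ?_⟩,
    mul_mem (S := Subalgebra ℂ (JetRing n)) hPu hQu⟩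
  rw [map_mul, map_mul, hP' f φ hf hφ h0 h1, hQ' f φ hf hφ h0 h1]
  ring

theorem one_mem_UEwt (n κ : ℕ) : (1 : JetRing n) ∈ UEwt n κ 0 :=
  ⟨⟨one_mem _, fun f φ _ _ _ _ => by simp⟩, one_mem (unipotentInvariants n)⟩

/-- The algebra `UE_κ^n` of bi-invariants: the sum of all `UE_{κ,m}^n` (the constants being the
bi-invariants of weight `0`). -/
def UE (n κ : ℕ) : Subalgebra ℂ (JetRing n) :=
  Submodule.toSubalgebra (⨆ m, UEwt n κ m)
    (Submodule.mem_iSup_of_mem 0 (one_mem_UEwt n κ))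
    (fun P Q hP hQ => by
      have h : (⨆ a, UEwt n κ a) * (⨆ b, UEwt n κ b) ≤ ⨆ m, UEwt n κ m := by
        rw [Submodule.iSup_mul]
        refine iSup_le fun a => ?_
        rw [Submodule.mul_iSup]
        exact iSup_le fun b => (UEwt_mul_le n κ a b).trans (le_iSup (UEwt n κ) (a + b))
      exact h (Submodule.mul_mem_mul hP hQ))

section Initial

variable {n : ℕ} [NeZero n]

/-- The variable `f_1'`. -/
def f1' (n : ℕ) [NeZero n] : JetRing n := X (0, 1)

/-- The total differentiation operator `D`, with `D f_i^{(l)} = f_i^{(l+1)}`. -/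
def totalD (n : ℕ) : Derivation ℂ (JetRing n) (JetRing n) :=
  mkDerivation ℂ fun p => X (p.1, p.2 + 1)

/-- The bracket `[P, Q] = k · DP · Q - m · P · DQ` of `P` of weight `m` and `Q` of weight `k`. -/
def bracket (m : ℕ) (P : JetRing n) (k : ℕ) (Q : JetRing n) : JetRing n :=
  (k : JetRing n) * totalD n P * Q - (m : JetRing n) * P * totalD n Q

/-- `initialLambda i r` is, with `l = r + 2`, the invariant `Λ_{1,i+1; 1^{l-2}}^{2l-1}` of weight
`2 l - 1 = 2 r + 3`, obtained from `[f_{i+1}', f_1']` by bracketing `r` times with `f_1'`. -/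
def initialLambda (i : Fin n) : ℕ → JetRing n
  | 0 => bracket 1 (X (i, 1)) 1 (f1' n)
  | r + 1 => bracket (2 * r + 3) (initialLambda i r) 1 (f1' n)

/-- The minor of size `p` of the matrix of the invariants `Λ_{1,i; 1^{l-2}}^{2l-1}`, with columns
`i = 2, …, p + 1` and with rows `l = r a + 2` for `a = 1, …, p`. -/
def lambdaMinor (p : ℕ) (hp : p < n) (r : Fin p → ℕ) : JetRing n :=
  Matrix.det (Matrix.of fun a b : Fin p =>
    initialLambda (⟨b.1 + 1, by have := b.2; omega⟩ : Fin n) (r a))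

/-- `P = (f_1')^ν R` where `(f_1')^ν` is the maximal power of `f_1'` that divides `P ≠ 0`. -/
def IsMaximalFactoring (P : JetRing n) (ν : ℕ) (R : JetRing n) : Prop :=
  P = f1' n ^ ν * R ∧ ¬ f1' n ∣ R

/-- `L`, of weight `l`, is one of the initial bi-invariants: it is the quotient of one of the
minors above, of rows `2 ≤ λ_2 < ⋯ < λ_{p+1} ≤ κ`, by the maximal power of `f_1'` dividing it. -/
def IsInitial (κ l : ℕ) (L : JetRing n) : Prop :=
  ∃ (p : ℕ) (hp : p < n) (r : Fin p → ℕ) (ν : ℕ), 1 ≤ p ∧ StrictMono r ∧ (∀ a, r a + 2 ≤ κ) ∧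
    IsMaximalFactoring (lambdaMinor p hp r) ν L ∧ ∑ a, (2 * r a + 3) = l + ν

end Initial

section Algorithm

variable {n : ℕ} [NeZero n]

/-- The restriction `P ↦ P|_0` of jet polynomials to `{f_1' = 0}`. -/
def restrict (n : ℕ) [NeZero n] : JetRing n →ₐ[ℂ] JetRing n :=
  aeval fun p => if p = (0, 1) then 0 else X p

/-- `Ideal-Rel(Λ_1|_0, …, Λ_M|_0)`. -/
def idealRel {M : ℕ} (Λ : Fin M → JetRing n) : Ideal (MvPolynomial (Fin M) ℂ) :=
  RingHom.ker (aeval fun j => restrict n (Λ j) : MvPolynomial (Fin M) ℂ →ₐ[ℂ] JetRing n)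

/-- `S` is a reduced Gröbner basis of `I`: it generates `I`, every leading monomial of `I` is
divisible by the leading monomial of some `S i`, and no monomial of `S i` is divisible by the
leading monomial of another `S j`. Leading coefficients are not required to be normalized to
`1`, so that integer multiples of the members are allowed. -/
structure IsReducedGroebnerBasis {M N : ℕ} (ord : MonomialOrder.{0, 0} (Fin M))
    (I : Ideal (MvPolynomial (Fin M) ℂ)) (S : Fin N → MvPolynomial (Fin M) ℂ) : Prop where
  span_eq : Ideal.span (Set.range S) = I
  ne_zero : ∀ i, S i ≠ 0
  leading : ∀ p ∈ I, p ≠ 0 → ∃ i, ord.degree (S i) ≤ ord.degree p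
  reduced : ∀ i j, i ≠ j → ∀ b ∈ (S i).support, ¬ ord.degree (S j) ≤ b

/-- The family `f_1', Λ_1, …, Λ_M`; `none` is the index of `f_1'`. -/
def withF1 {M : ℕ} (Λ : Fin M → JetRing n) : Option (Fin M) → JetRing n :=
  fun o => o.elim (f1' n) Λ

/-- The weights `1, ℓ_1, …, ℓ_M` of the family `f_1', Λ_1, …, Λ_M`. -/
def withF1Weight {M : ℕ} (ℓ : Fin M → ℕ) : Option (Fin M) → ℕ :=
  fun o => o.elim 1 ℓ

/-- The algebra `ℂ[f_1', Λ_1, …, Λ_M]` generated by `f_1'` and the `Λ_j`. -/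
def generated {M : ℕ} (Λ : Fin M → JetRing n) : Subalgebra ℂ (JetRing n) :=
  Algebra.adjoin ℂ (Set.range (withF1 Λ))

/-- No member of the family is a polynomial in the other members. -/
def MutuallyIndependent {ι : Type} (g : ι → JetRing n) : Prop :=
  ∀ o, g o ∉ Algebra.adjoin ℂ (g '' {o}ᶜ)

/-- One loop of the algorithm, performed on the list `Λ` of weights `ℓ`, adds the list `Λ'` of
weights `ℓ'`. The loop picks a reduced Gröbner basis `S` of the ideal of relations between the
restrictions of the `Λ_j` to `{f_1' = 0}`, homogeneous of weights `μ`, and factors every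
`S i (Λ) ≠ 0` as `(f_1')^ν R` with `ν` maximal. The members of `Λ'` are remainders `R` so obtained,
of weights `μ i - ν`, each of them being no polynomial in `f_1'`, the `Λ_j` and the preceding
members of `Λ'`, and all the remainders are polynomials in `f_1'`, the `Λ_j` and the members
of `Λ'`. -/
def IsLoop {M k : ℕ} (ℓ : Fin M → ℕ) (Λ : Fin M → JetRing n)
    (ℓ' : Fin k → ℕ) (Λ' : Fin k → JetRing n) : Prop :=
  ∃ (ord : MonomialOrder.{0, 0} (Fin M)) (N : ℕ) (S : Fin N → MvPolynomial (Fin M) ℂ)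
    (μ : Fin N → ℕ),
    IsReducedGroebnerBasis ord (idealRel Λ) S ∧
    (∀ i, IsWeightedHomogeneous ℓ (S i) (μ i)) ∧
    (∀ j, ∃ i ν, IsMaximalFactoring (aeval Λ (S i)) ν (Λ' j) ∧ μ i = ℓ' j + ν) ∧
    (∀ j, Λ' j ∉ Algebra.adjoin ℂ (Set.range (withF1 Λ) ∪ Λ' '' {j' | j' < j})) ∧
    ∀ i ν R, IsMaximalFactoring (aeval Λ (S i)) ν R →
      R ∈ Algebra.adjoin ℂ (Set.range (withF1 Λ) ∪ Set.range Λ')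

/-- The lists `Λ_1, …, Λ_M`, with their weights `ℓ_1, …, ℓ_M`, that are obtained (in addition to
`f_1'`) after finitely many loops of the algorithm for jets of order `κ` in dimension `n`, starting
from the list of the initial bi-invariants. Between the loops, the list may be renumbered and
members which are polynomials in `f_1'` and the members that are kept may be left out. -/
inductive AlgorithmOutput (n κ : ℕ) [NeZero n] :
    (M : ℕ) → (Fin M → ℕ) → (Fin M → JetRing n) → Prop
  | init {M : ℕ} (ℓ : Fin M → ℕ) (Λ : Fin M → JetRing n) (inj : Function.Injective Λ)
      (sound : ∀ j, IsInitial κ (ℓ j) (Λ j))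
      (complete : ∀ l L, IsInitial κ l L → ∃ j, ℓ j = l ∧ Λ j = L) :
      AlgorithmOutput n κ M ℓ Λ
  | loop {M k : ℕ} (ℓ : Fin M → ℕ) (Λ : Fin M → JetRing n) (ℓ' : Fin k → ℕ)
      (Λ' : Fin k → JetRing n) (prev : AlgorithmOutput n κ M ℓ Λ) (step : IsLoop ℓ Λ ℓ' Λ') :
      AlgorithmOutput n κ (M + k) (Fin.append ℓ ℓ') (Fin.append Λ Λ')
  | prune {M M' : ℕ} (ℓ : Fin M → ℕ) (Λ : Fin M → JetRing n) (e : Fin M' ↪ Fin M)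
      (prev : AlgorithmOutput n κ M ℓ Λ) (redundant : ∀ j, Λ j ∈ generated (Λ ∘ e)) :
      AlgorithmOutput n κ M' (ℓ ∘ e) (Λ ∘ e)

/-- The data of a Gröbner-normalized form of weight `m`: polynomials `P_a`, for `0 ≤ a ≤ m`,
homogeneous of weight `m - a`, whose monomials have exponents outside of all the quadrants
`□_i = α i + ℕ^M`. -/
def IsGroebnerNormalized {M N : ℕ} (ℓ : Fin M → ℕ) (α : Fin N → (Fin M →₀ ℕ)) (m : ℕ)
    (P : Fin (m + 1) → MvPolynomial (Fin M) ℂ) : Prop :=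
  ∀ a, IsWeightedHomogeneous ℓ (P a) (m - a.1) ∧ ∀ b ∈ (P a).support, ∀ i, ¬ α i ≤ b

/-- The jet polynomial `∑_{0 ≤ a ≤ m} (f_1')^a P_a(Λ_1, …, Λ_M)`. -/
def normalForm {M m : ℕ} (Λ : Fin M → JetRing n)
    (P : Fin (m + 1) → MvPolynomial (Fin M) ℂ) : JetRing n :=
  ∑ a : Fin (m + 1), f1' n ^ a.1 * aeval Λ (P a)

end Algorithm

end BiInvariant

end

open BiInvariant MvPolynomial

/-!
Why the theorem holds. Everything rests on two facts about the algebra generated by `f_1'` and the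
`Λ_j`: it contains every bi-invariant up to a power of `f_1'`, and it is saturated with respect
to `f_1'`.

*Bi-invariants up to powers of `f_1'`* (`exists_f1'_pow_mul_mem`). Where `f_1' ≠ 0`, the jet of `f`
can be reparametrized by the inverse of `f_1`, and a unipotent matrix then annihilates the first
derivatives of the other components. The jet so obtained has the entries
`Λ_{1,i}^{2l-1} / (f_1')^{2l-1}` for `i, l ≥ 2` (`iteratedDeriv_comp_inverse`,
`eval_eq_slicePoint`). A bi-invariant is therefore `(f_1')^m` times a polynomial in these entries,
which is still invariant under the unipotent group of size `n - 1` (`shear_slice`). By the first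
fundamental theorem for this group (`mem_flagAlgebra_of_shear`), that polynomial is a polynomial in
the minors on the first rows, which are minors of initial bi-invariants divided by powers of `f_1'`.

*The first fundamental theorem* is proved by comparing leading monomials for a suitable
lexicographic order. An invariant is killed by the polarization operators of pairs of rows. A weight
argument for `SL_2` (`rowDegree_le_of_polarization_eq_zero`) shows that its leading exponent is the
content of a semistandard tableau (`sum_row_le_of_polarization_eq_zero`). The columns of the tableau
are the leading exponents of minors, so that some product of minors has the same leading monomial
(`IsTableauExponent.exists_mem_flagAlgebra`); subtracting a multiple of it lowers the degree.

*Saturation* (`mem_generated_of_f1'_mul`). If `f_1' Q = H_0(Λ) + f_1' H_1(f_1', Λ)`, then `H_0` is a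
relation between the `Λ_j|_0`, hence a combination of the `S_i`, and `S_i(Λ)` is `f_1'` times an
element of the algebra by hypothesis. This gives generation, and termination as well, since a
remainder times a power of `f_1'` is a polynomial in the `Λ_j`.

*Normal forms.* Dividing by the Gröbner basis and replacing `S_i` by `F R_i` brings every polynomial
in `F, A_1, …, A_M` to normal form modulo the syzygies (`exists_normalPolynomial`), by induction on
the weight. Restriction to `f_1' = 0` shows that a normal form which vanishes on `f_1', Λ_1, …, Λ_M`
is zero (`eq_zero_of_normalForm_eq_zero`). Together these give the unique normal form of
bi-invariants and show that the syzygies generate all relations.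
-/

open BiInvariant MvPolynomial

namespace BiInvariant

/-! ### Homogeneous polynomials and the chain rule -/

theorem derivative_algHom {σ : Type*} (φ : MvPolynomial σ ℂ →ₐ[ℂ] Polynomial ℂ)
    (D : Derivation ℂ (MvPolynomial σ ℂ) (MvPolynomial σ ℂ))
    (h : ∀ v, Polynomial.derivative (φ (X v)) = φ (D (X v))) (P : MvPolynomial σ ℂ) :
    Polynomial.derivative (φ P) = φ (D P) := by
  induction P using MvPolynomial.induction_on with
  | C a =>
    rw [← algebraMap_eq, AlgHom.commutes, Derivation.map_algebraMap, map_zero]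
    exact Polynomial.derivative_C
  | add p q hp hq => simp only [map_add, hp, hq]
  | mul_X p v hp =>
    rw [map_mul, Polynomial.derivative_mul, hp, h, Derivation.leibniz]
    simp only [map_add, smul_eq_mul, map_mul]
    ring

theorem eval_pow_mul_of_isWeightedHomogeneous {σ : Type*} {w : σ → ℕ} {P : MvPolynomial σ ℂ} {A : ℕ}
    (h : IsWeightedHomogeneous w P A) (s : ℂ) (ρ : σ → ℂ) :
    eval (fun v => s ^ w v * ρ v) P = s ^ A * eval ρ P := by
  rw [eval_eq, eval_eq, Finset.mul_sum]
  refine Finset.sum_congr rfl fun d hd => ?_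
  have h1 := h (mem_support_iff.1 hd)
  rw [← h1, Finsupp.weight_apply, Finsupp.sum, ← Finset.prod_pow_eq_pow_sum]
  simp only [mul_pow, Finset.prod_mul_distrib, smul_eq_mul, ← pow_mul]
  rw [mul_left_comm]
  simp only [mul_comm]

theorem natDegree_aeval_le_of_isWeightedHomogeneous {σ : Type*} {w : σ → ℕ} {P : MvPolynomial σ ℂ}
    {A : ℕ} (h : IsWeightedHomogeneous w P A) (g : σ → Polynomial ℂ)
    (hg : ∀ v, (g v).natDegree ≤ w v) : (aeval g P).natDegree ≤ A := by
  rw [aeval_def, eval₂_eq]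
  refine Polynomial.natDegree_sum_le_of_forall_le _ _ fun d hd => ?_
  have h1 := h (mem_support_iff.1 hd)
  rw [← h1, Finsupp.weight_apply, Finsupp.sum]
  refine (Polynomial.natDegree_C_mul_le _ _).trans ((Polynomial.natDegree_prod_le _ _).trans ?_)
  refine Finset.sum_le_sum fun v _ => ?_
  exact Polynomial.natDegree_pow_le.trans (Nat.mul_le_mul_left _ (hg v))

/-! ### Row operations and polarization operators -/

section Polarization

variable {ι τ : Type} [DecidableEq ι] [DecidableEq τ] [Fintype τ]

/-- The substitution that adds to the `j`-th row of the matrix of variables `t` times its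
`i`-th row. -/
noncomputable def shear (i j : ι) (t : ℂ) : MvPolynomial (ι × τ) ℂ →ₐ[ℂ] MvPolynomial (ι × τ) ℂ :=
  aeval fun v => if v.1 = j then X v + C t * X (i, v.2) else X v

/-- The polarization operator `∑_l X_{i,l} ∂/∂X_{j,l}`, the infinitesimal generator of the
one-parameter group of the substitutions `shear i j t`. -/
noncomputable def polarization (i j : ι) :
    Derivation ℂ (MvPolynomial (ι × τ) ℂ) (MvPolynomial (ι × τ) ℂ) :=
  ∑ l, (X (i, l) : MvPolynomial (ι × τ) ℂ) • pderiv (j, l)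

theorem polarization_apply (i j : ι) (P : MvPolynomial (ι × τ) ℂ) :
    polarization i j P = ∑ l, X (i, l) * pderiv (j, l) P := by
  have := map_sum (Derivation.coeFnAddMonoidHom :
    Derivation ℂ (MvPolynomial (ι × τ) ℂ) (MvPolynomial (ι × τ) ℂ) →+ _)
    (fun l => (X (i, l) : MvPolynomial (ι × τ) ℂ) • pderiv (j, l)) Finset.univ
  exact (congrFun this P).trans (Finset.sum_apply _ _ _)

theorem polarization_X (i j : ι) (v : ι × τ) :
    polarization i j (X v) = if v.1 = j then X (i, v.2) else (0 : MvPolynomial (ι × τ) ℂ) := by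
  obtain ⟨a, l⟩ := v
  rw [polarization_apply]
  split_ifs with h
  · dsimp only at h
    subst h
    rw [Finset.sum_eq_single l]
    · simp
    · intro b _ hb
      rw [pderiv_X_of_ne (by simpa using Ne.symm hb), mul_zero]
    · simp
  · refine Finset.sum_eq_zero fun b _ => ?_
    rw [pderiv_X_of_ne (by rintro h'; exact h (by simpa using congrArg Prod.fst h')), mul_zero]

/-- The restriction of a polynomial to the orbit of the point `ρ` under the one-parameter group
`shear i j`, as a polynomial in the parameter. -/
noncomputable def shearOrbit (i j : ι) (ρ : ι × τ → ℂ) : MvPolynomial (ι × τ) ℂ →ₐ[ℂ] Polynomial ℂ :=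
  aeval fun v => Polynomial.C (ρ v) +
    if v.1 = j then Polynomial.X * Polynomial.C (ρ (i, v.2)) else 0

theorem derivative_shearOrbit {i j : ι} (hij : i ≠ j) (ρ : ι × τ → ℂ)
    (P : MvPolynomial (ι × τ) ℂ) :
    Polynomial.derivative (shearOrbit i j ρ P) = shearOrbit i j ρ (polarization i j P) := by
  refine derivative_algHom _ _ (fun v => ?_) P
  rw [polarization_X]
  split_ifs with h <;> simp [shearOrbit, h, hij]

theorem eval_shearOrbit (i j : ι) (ρ : ι × τ → ℂ) (P : MvPolynomial (ι × τ) ℂ) (t : ℂ) :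
    (shearOrbit i j ρ P).eval t =
      eval (fun v => if v.1 = j then ρ v + t * ρ (i, v.2) else ρ v) P := by
  have : ((Polynomial.aeval t).comp (shearOrbit i j ρ)) =
      aeval (fun v => if v.1 = j then ρ v + t * ρ (i, v.2) else ρ v) := by
    ext v
    by_cases h : v.1 = j
    · simp [shearOrbit, h]
      ring
    · simp [shearOrbit, h]
  have h := DFunLike.congr_fun this P
  rw [AlgHom.comp_apply, Polynomial.coe_aeval_eq_eval] at h
  exact h

theorem eval_shear (i j : ι) (ρ : ι × τ → ℂ) (P : MvPolynomial (ι × τ) ℂ) (t : ℂ) :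
    eval ρ (shear i j t P) = (shearOrbit i j ρ P).eval t := by
  rw [eval_shearOrbit]
  have : ((aeval ρ : MvPolynomial (ι × τ) ℂ →ₐ[ℂ] ℂ).comp (shear i j t)) =
      aeval (fun v => if v.1 = j then ρ v + t * ρ (i, v.2) else ρ v) := by
    ext v
    by_cases h : v.1 = j <;> simp [shear, h]
  exact DFunLike.congr_fun this P

theorem polarization_eq_zero_of_shear {i j : ι} (hij : i ≠ j) {P : MvPolynomial (ι × τ) ℂ}
    (h : ∀ t, shear i j t P = P) : polarization i j P = 0 := by
  refine MvPolynomial.funext fun ρ => ?_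
  have hc : shearOrbit i j ρ P = Polynomial.C (eval ρ P) := by
    refine Polynomial.funext fun t => ?_
    rw [← eval_shear, h, Polynomial.eval_C]
  have h1 := derivative_shearOrbit hij ρ P
  rw [hc, Polynomial.derivative_C] at h1
  have h2 := eval_shearOrbit i j ρ (polarization i j P) 0
  rw [← h1] at h2
  simpa using h2.symm

theorem eval_eq_of_polarization_eq_zero {i j : ι} (hij : i ≠ j) {P : MvPolynomial (ι × τ) ℂ}
    (h : polarization i j P = 0) (ρ : ι × τ → ℂ) (t : ℂ) :
    eval (fun v => if v.1 = j then ρ v + t * ρ (i, v.2) else ρ v) P = eval ρ P := by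
  have h1 := derivative_shearOrbit hij ρ P
  rw [h, map_zero] at h1
  have h2 := Polynomial.eq_C_of_derivative_eq_zero h1
  have h3 := eval_shearOrbit i j ρ P t
  have h4 := eval_shearOrbit i j ρ P 0
  rw [h2, Polynomial.eval_C] at h3 h4
  rw [← h3, h4]
  simp

/-- A polynomial killed by the polarization operator is a highest weight vector for an action of
`SL_2`, so that its weight `A - B` is nonnegative. Invariance and homogeneity give
`s^B P(z - s y, y) = P(z - s y, z)`, where the right-hand side has degree at most `A` in `s`. -/
theorem rowDegree_le_of_polarization_eq_zero {i j : ι} (hij : i ≠ j) {P : MvPolynomial (ι × τ) ℂ}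
    (hP : P ≠ 0) (hE : polarization i j P = 0) {A B : ℕ}
    (hA : IsWeightedHomogeneous (fun v : ι × τ => if v.1 = i then 1 else 0) P A)
    (hB : IsWeightedHomogeneous (fun v : ι × τ => if v.1 = j then 1 else 0) P B) : B ≤ A := by
  obtain ⟨ρ, hρ⟩ : ∃ ρ, eval ρ P ≠ 0 := by
    by_contra! h
    exact hP (MvPolynomial.funext fun ρ => by rw [h, map_zero])
  let g : (τ → ℂ) → ι × τ → Polynomial ℂ := fun y v =>
    if v.1 = i then Polynomial.C (ρ v) - Polynomial.X * Polynomial.C (ρ (j, v.2))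
    else if v.1 = j then Polynomial.C (y v.2) else Polynomial.C (ρ v)
  let G : (τ → ℂ) → MvPolynomial (ι × τ) ℂ →ₐ[ℂ] Polynomial ℂ := fun y => aeval (g y)
  let p : Polynomial ℂ := G (fun l => ρ (i, l)) P
  let q : Polynomial ℂ := G (fun l => ρ (j, l)) P
  have hev : ∀ y s, (G y P).eval s = eval (fun v => (g y v).eval s) P := by
    intro y s
    have : ((Polynomial.aeval s).comp (G y)) =
        aeval (fun v => (g y v).eval s) := by
      ext v
      simp [G]
    have := DFunLike.congr_fun this P
    rw [AlgHom.comp_apply] at this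
    simpa [aeval_eq_eval] using this
  have hpq : Polynomial.X ^ B * q = p := by
    refine Polynomial.eq_of_infinite_eval_eq _ _
      (Set.Infinite.mono ?_ (Set.Finite.infinite_compl (Set.finite_singleton (0 : ℂ))))
    intro s hs
    have hs : s ≠ 0 := hs
    simp only [Set.mem_ofPred_eq, Polynomial.eval_mul, Polynomial.eval_pow, Polynomial.eval_X]
    simp only [p, q, hev]
    rw [← eval_eq_of_polarization_eq_zero hij hE (fun v => (g (fun l => ρ (j, l)) v).eval s) s⁻¹,
      ← eval_pow_mul_of_isWeightedHomogeneous hB s]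
    congr 2
    funext v
    by_cases h1 : v.1 = j
    · have h2 : v.1 ≠ i := fun h => hij (h.symm.trans h1)
      have h3 : (j, v.2) = v := by rw [← h1]
      simp [g, h1, hij, hij.symm, h3]
      field_simp
      ring
    · by_cases h2 : v.1 = i
      · simp [g, h1, h2, hij]
      · simp [g, h1, h2]
  have hq : q ≠ 0 := by
    intro h
    apply hρ
    have := hev (fun l => ρ (j, l)) 0
    rw [show G (fun l => ρ (j, l)) P = 0 from h, Polynomial.eval_zero] at this
    rw [this]
    congr 2
    funext v
    by_cases h1 : v.1 = j
    · have h3 : (j, v.2) = v := by rw [← h1]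
      simp [g, h1, hij.symm, h3]
    · by_cases h2 : v.1 = i
      · simp [g, h2]
      · simp [g, h1, h2]
  have hdeg : p.natDegree ≤ A := by
    refine natDegree_aeval_le_of_isWeightedHomogeneous hA _ fun v => ?_
    by_cases h2 : v.1 = i
    · simp only [g, h2, if_true]
      refine (Polynomial.natDegree_sub_le _ _).trans (max_le (by simp) ?_)
      exact (Polynomial.natDegree_mul_C_le _ _).trans Polynomial.natDegree_X_le
    · by_cases h1 : v.1 = j <;> simp [g, h2, h1, hij.symm]
  rw [← hpq, Polynomial.natDegree_X_pow_mul _ hq] at hdeg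
  omega

theorem coeff_polarization {i j : ι} (hij : i ≠ j) (P : MvPolynomial (ι × τ) ℂ)
    (e : ι × τ →₀ ℕ) :
    coeff e (polarization i j P) = ∑ l, if e (i, l) = 0 then 0 else
      coeff (e - Finsupp.single (i, l) 1 + Finsupp.single (j, l) 1) P * ((e (j, l) : ℂ) + 1) := by
  rw [polarization_apply, coeff_sum]
  refine Finset.sum_congr rfl fun l _ => ?_
  rw [coeff_X_mul', coeff_pderiv]
  simp only [Finsupp.mem_support_iff, ne_eq, ite_not]
  congr 3
  simp [hij]

end Polarization

/-! ### Leading exponents of unipotent invariants -/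

section FlagMinors

variable {p k : ℕ}

/-- The order of the variables, decreasing in the column first and in the row second, that is
used for the lexicographic comparison of monomials. -/
def columnEquiv (p k : ℕ) : Fin p × Fin k ≃ (Fin k ×ₗ Fin p)ᵒᵈ :=
  (Equiv.prodComm _ _).trans (toLex.trans OrderDual.toDual)

/-- The lexicographic monomial order on the variables of a `p × k` matrix for which a variable is
the larger the further to the right its column is and, within a column, the lower its row is. -/
noncomputable def columnOrder (p k : ℕ) : MonomialOrder.{0, 0} (Fin p × Fin k) where
  syn := Lex ((Fin k ×ₗ Fin p)ᵒᵈ →₀ ℕ)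
  toSyn := (Finsupp.domCongr (columnEquiv p k)).trans (MonomialOrder.lex).toSyn
  toSyn_monotone := fun c d h => by
    refine (MonomialOrder.lex).toSyn_monotone fun v => ?_
    exact h _

theorem columnOrder_lt {c d : Fin p × Fin k →₀ ℕ} (v : Fin p × Fin k)
    (h : ∀ u : Fin p × Fin k, v.2 < u.2 ∨ v.2 = u.2 ∧ v.1 < u.1 → c u = d u) (hv : c v < d v) :
    (columnOrder p k).toSyn c < (columnOrder p k).toSyn d := by
  refine Finsupp.Lex.lt_iff.2 ⟨columnEquiv p k v, fun u hu => ?_, ?_⟩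
  · have hu' : toLex (v.2, v.1) < (OrderDual.ofDual u : Fin k ×ₗ Fin p) := hu
    rw [Prod.Lex.lt_iff] at hu'
    exact h ((columnEquiv p k).symm u) hu'
  · change c ((columnEquiv p k).symm (columnEquiv p k v)) <
      d ((columnEquiv p k).symm (columnEquiv p k v))
    rwa [Equiv.symm_apply_apply]

theorem isWeightedHomogeneous_row (i : Fin p) {P : MvPolynomial (Fin p × Fin k) ℂ} {A : ℕ}
    (h : ∀ e, coeff e P ≠ 0 → ∑ l, e (i, l) = A) :
    IsWeightedHomogeneous (fun v : Fin p × Fin k => if v.1 = i then 1 else 0) P A := by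
  intro e he
  rw [← h e he, Finsupp.weight_apply, Finsupp.sum_fintype _ _ (by simp), Fintype.sum_prod_type,
    Finset.sum_eq_single i]
  · simp
  · intro b _ hb
    simp [hb]
  · simp

/-- The leading exponent of a polynomial killed by a polarization operator satisfies the
inequalities that characterize the contents of the rows of semistandard tableaux. To see this, the
factor depending on the other rows, on the columns after `l` and on the variable `(i, l)` is
removed from the leading monomial `d`; the terms of `P` that contain this factor and agree with
`d` in the degree of column `l` and in the degrees of the two rows then form a polynomial which is
killed by the same operator, the terms that could interfere being larger than `d`. -/
theorem sum_row_le_of_polarization_eq_zero {i j : Fin p} (hij : i < j)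
    {P : MvPolynomial (Fin p × Fin k) ℂ} (hP : P ≠ 0) (hE : polarization i j P = 0) (l : Fin k) :
    ∑ x with x ≤ l, (columnOrder p k).degree P (j, x) ≤
      ∑ x with x < l, (columnOrder p k).degree P (i, x) := by
  classical
  set d := (columnOrder p k).degree P with hd
  have hbig : ∀ c v, (∀ u : Fin p × Fin k, v.2 < u.2 ∨ v.2 = u.2 ∧ v.1 < u.1 → d u = c u) →
      d v < c v → coeff c P = 0 := fun c v h1 h2 =>
    (columnOrder p k).coeff_eq_zero_of_lt (columnOrder_lt v h1 h2)
  let far : Fin p × Fin k → Prop := fun v => (v.1 ≠ i ∧ v.1 ≠ j) ∨ l < v.2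
  let d0 : Fin p × Fin k →₀ ℕ :=
    Finsupp.equivFunOnFinite.symm fun v => if far v ∨ v = (i, l) then d v else 0
  let e0 : Fin p × Fin k →₀ ℕ :=
    Finsupp.equivFunOnFinite.symm fun v => if far v ∨ v = (i, l) then 0 else d v
  have hd0 : ∀ v, d0 v = if far v ∨ v = (i, l) then d v else 0 := fun v => rfl
  have he0 : ∀ v, e0 v = if far v ∨ v = (i, l) then 0 else d v := fun v => rfl
  have hsum : e0 + d0 = d := by
    ext v
    rw [Finsupp.add_apply, hd0, he0]
    split_ifs <;> simp
  set A := ∑ x with x < l, d (i, x) with hA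
  set B := ∑ x with x ≤ l, d (j, x) with hB
  let Good : ℕ → ℕ → (Fin p × Fin k →₀ ℕ) → Prop := fun a b e =>
    (∀ v, far v → e v = 0) ∧ e (i, l) + e (j, l) = d (j, l) ∧
      ∑ x, e (i, x) = a ∧ ∑ x, e (j, x) = b
  let V : MvPolynomial (Fin p × Fin k) ℂ :=
    ∑ e ∈ (divMonomial P d0).support.filter (Good A B), monomial e (coeff e (divMonomial P d0))
  have hV : ∀ e, coeff e V = if Good A B e then coeff (e + d0) P else 0 := by
    intro e
    simp only [V, coeff_sum, coeff_monomial]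
    rw [Finset.sum_ite_eq']
    simp only [Finset.mem_filter, mem_support_iff, coeff_divMonomial, add_comm d0]
    split_ifs with h1 h2 h2
    · rfl
    · exact absurd h1.2 h2
    · by_contra h3
      exact h1 ⟨fun h => h3 h.symm, h2⟩
    · rfl
  have hij' : i ≠ j := hij.ne
  have hgood0 : Good A B e0 := by
    refine ⟨fun v hv => by rw [he0, if_pos (Or.inl hv)], ?_, ?_, ?_⟩
    · rw [he0, he0, if_pos (Or.inr rfl), if_neg, zero_add]
      simp [far, hij'.symm]
    · rw [hA, Finset.sum_filter]
      refine Finset.sum_congr rfl fun x _ => ?_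
      rw [he0]
      rcases lt_trichotomy x l with h | h | h
      · simp [far, h, h.ne, h.not_gt]
      · simp [far, h]
      · simp [far, h, h.not_gt]
    · rw [hB, Finset.sum_filter]
      refine Finset.sum_congr rfl fun x _ => ?_
      rw [he0]
      rcases le_or_gt x l with h | h
      · simp [far, h, hij'.symm, h.not_gt]
      · simp [far, h, hij'.symm, h.not_ge]
  have hV0 : V ≠ 0 := by
    intro h
    have := hV e0
    rw [if_pos hgood0, hsum, h, coeff_zero] at this
    exact ((columnOrder p k).coeff_degree_ne_zero_iff).2 hP this.symm
  -- moving one unit from row `i` to row `j` within a column changes the row degrees only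
  have hmove : ∀ (f : Fin p × Fin k →₀ ℕ) (x : Fin k) (a b : ℕ),
      Good a (b + 1) (f + Finsupp.single (j, x) 1) ↔ Good (a + 1) b (f + Finsupp.single (i, x) 1) := by
    intro f x a b
    have h1 : (∀ v, far v → (f + Finsupp.single (j, x) 1 : Fin p × Fin k →₀ ℕ) v = 0) ↔
        ∀ v, far v → (f + Finsupp.single (i, x) 1 : Fin p × Fin k →₀ ℕ) v = 0 := by
      have hf : ∀ y : Fin p, (y = i ∨ y = j) → (far (y, x) ↔ l < x) := by
        rintro y (rfl | rfl) <;> simp [far]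
      have key : ∀ y : Fin p, (y = i ∨ y = j) →
          ((∀ v, far v → (f + Finsupp.single (y, x) 1 : Fin p × Fin k →₀ ℕ) v = 0) ↔
            (∀ v, far v → f v = 0) ∧ ¬ l < x) := by
        intro y hy
        constructor
        · intro h
          refine ⟨fun v hv => by have := h v hv; simp at this; exact this.1, fun hl => ?_⟩
          have := h (y, x) ((hf y hy).2 hl)
          simp at this
        · rintro ⟨h, hl⟩ v hv
          rw [Finsupp.add_apply, h v hv, Finsupp.single_apply,
            if_neg fun h' : (y, x) = v => hl ((hf y hy).1 (h' ▸ hv)), add_zero]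
      rw [key j (Or.inr rfl), key i (Or.inl rfl)]
    have h2 : (f + Finsupp.single (j, x) 1 : Fin p × Fin k →₀ ℕ) (i, l) + (f + Finsupp.single (j, x) 1 : Fin p × Fin k →₀ ℕ) (j, l) =
        (f + Finsupp.single (i, x) 1 : Fin p × Fin k →₀ ℕ) (i, l) + (f + Finsupp.single (i, x) 1 : Fin p × Fin k →₀ ℕ) (j, l) := by
      by_cases hx : x = l <;> simp [hij', hij'.symm, hx]
      ring
    have h3 : ∀ y y' : Fin p, ∑ z, (f + Finsupp.single (y, x) 1 : Fin p × Fin k →₀ ℕ) (y', z) =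
        ∑ z, f (y', z) + if y = y' then 1 else 0 := by
      intro y y'
      simp only [Finsupp.add_apply, Finset.sum_add_distrib, Finsupp.single_apply, Prod.mk.injEq]
      by_cases hy : y = y' <;> simp [hy]
    simp only [Good]
    rw [h1, h2, h3, h3, h3, h3]
    simp [hij', hij'.symm]
  have hEV : polarization i j V = 0 := by
    ext e
    rw [coeff_polarization hij', coeff_zero]
    by_cases hB0 : B = 0
    · refine Finset.sum_eq_zero fun x _ => ?_
      split_ifs with hx
      · rfl
      · rw [hV, if_neg, zero_mul]
        rintro ⟨-, -, -, h⟩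
        rw [hB0, Finset.sum_eq_zero_iff] at h
        have := h x (Finset.mem_univ _)
        simp at this
    obtain ⟨B', hB'⟩ : ∃ B', B = B' + 1 := ⟨B - 1, by omega⟩
    have hdec : ∀ x, e (i, x) ≠ 0 →
        e - Finsupp.single (i, x) 1 + Finsupp.single (i, x) 1 = e := fun x hx =>
      tsub_add_cancel_of_le (Finsupp.single_le_iff.2 (Nat.one_le_iff_ne_zero.2 hx))
    by_cases hg : Good (A + 1) B' e
    · have h0 : coeff (e + d0) (polarization i j P) = 0 := by rw [hE, coeff_zero]
      rw [coeff_polarization hij'] at h0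
      refine Eq.trans (Finset.sum_congr rfl fun x _ => ?_) h0
      rcases lt_or_ge l x with hx | hx
      · -- the terms from a column behind `l` are larger than the leading one
        have h1 : e (i, x) = 0 := hg.1 _ (Or.inr hx)
        rw [if_pos h1]
        split_ifs with h2
        · rfl
        · rw [hbig _ (j, x), zero_mul]
          · rintro ⟨a, z⟩ hu
            have hz : l < z := by
              rcases hu with hu | hu
              · exact hx.trans hu
              · exact hx.trans_eq hu.1
            have h3 : e (a, z) = 0 := hg.1 _ (Or.inr hz)
            have h4 : d0 (a, z) = d (a, z) := by rw [hd0, if_pos (Or.inl (Or.inr hz))]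
            have h5 : (i, x) ≠ (a, z) := by
              rintro h
              simp only [Prod.mk.injEq] at h
              rcases hu with hu | hu
              · exact hu.ne h.2
              · exact lt_asymm hij (h.1 ▸ hu.2)
            have h6 : (j, x) ≠ (a, z) := by
              rintro h
              simp only [Prod.mk.injEq] at h
              rcases hu with hu | hu
              · exact hu.ne h.2
              · exact hu.2.ne h.1
            simp [h3, h4, h5, h6]
          · have h4 : d0 (j, x) = d (j, x) := by rw [hd0, if_pos (Or.inl (Or.inr hx))]
            simp [h4, hij', hg.1 (j, x) (Or.inr hx)]
      · have hnf : ¬ far (j, x) := by simp [far, hx]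
        have hnf' : ¬ far (i, x) := by simp [far, hx]
        have hj0 : d0 (j, x) = 0 := by
          rw [hd0, if_neg]
          rintro (h | h)
          · exact hnf h
          · exact hij'.symm (congrArg Prod.fst h)
        by_cases hex : e (i, x) = 0
        · rw [if_pos hex]
          split_ifs with h2
          · rfl
          · have hxl : x = l := by
              by_contra hxl
              rw [Finsupp.add_apply, hex, hd0, if_neg] at h2
              · exact h2 rfl
              · rintro (h | h)
                · exact hnf' h
                · exact hxl (congrArg Prod.snd h)
            subst hxl
            rw [hbig _ (j, x), zero_mul]
            · rintro ⟨a, z⟩ hu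
              have hz : far (a, z) := by
                rcases hu with hu | hu
                · exact Or.inr hu
                · exact Or.inl ⟨(hij.trans hu.2).ne', hu.2.ne'⟩
              have h3 : e (a, z) = 0 := hg.1 _ hz
              have h4 : d0 (a, z) = d (a, z) := by rw [hd0, if_pos (Or.inl hz)]
              have h5 : (i, x) ≠ (a, z) := fun h => hnf' (h ▸ hz)
              have h6 : (j, x) ≠ (a, z) := fun h => hnf (h ▸ hz)
              simp [h3, h4, h5, h6]
            · have := hg.2.1
              rw [hex, zero_add] at this
              simp [hj0, hij', this]
        · have h1 : (e + d0) (i, x) ≠ 0 := by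
            rw [Finsupp.add_apply]; omega
          rw [if_neg hex, if_neg h1, hV, if_pos]
          · have h2 : e - Finsupp.single (i, x) 1 + Finsupp.single (j, x) 1 + d0 =
                e + d0 - Finsupp.single (i, x) 1 + Finsupp.single (j, x) 1 := by
              conv_rhs => rw [← hdec x hex, add_right_comm, add_tsub_cancel_right]
              rw [add_right_comm]
            rw [h2, Finsupp.add_apply, hj0, add_zero]
          · rw [hB', hmove, hdec x hex]
            exact hg
    · refine Finset.sum_eq_zero fun x _ => ?_
      split_ifs with hx
      · rfl
      · rw [hV, if_neg, zero_mul]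
        rwa [hB', hmove, hdec x hx]
  refine rowDegree_le_of_polarization_eq_zero hij' hV0 hEV
    (isWeightedHomogeneous_row i fun e he => ?_) (isWeightedHomogeneous_row j fun e he => ?_)
  · rw [hV] at he
    by_contra h
    exact he (if_neg fun hg => h hg.2.2.1)
  · rw [hV] at he
    by_contra h
    exact he (if_neg fun hg => h hg.2.2.2)

end FlagMinors

/-! ### The first fundamental theorem for the unipotent group -/

section FlagMinorsGenerate

variable {p k : ℕ}

/-- The minor, with rows `0, …, s - 1` and with columns `r 0, r 1, …`, of the generic `p × k`
matrix of variables, written as the determinant of the transposed matrix. -/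
noncomputable def flagMinor (s : ℕ) (hs : s ≤ p) (r : Fin s → Fin k) :
    MvPolynomial (Fin p × Fin k) ℂ :=
  Matrix.det (Matrix.of fun a b : Fin s => X (Fin.castLE hs b, r a))

theorem shear_flagMinor {i j : Fin p} (hij : i < j) (t : ℂ) (s : ℕ) (hs : s ≤ p)
    (r : Fin s → Fin k) : shear i j t (flagMinor s hs r) = flagMinor s hs r := by
  rw [flagMinor, AlgHom.map_det, ← Matrix.det_transpose]
  conv_rhs => rw [← Matrix.det_transpose]
  by_cases hj : j.1 < s
  · let j' : Fin s := ⟨j, hj⟩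
    let i' : Fin s := ⟨i, lt_trans hij hj⟩
    have hne : j' ≠ i' := fun h => hij.ne' (by simpa [j', i', Fin.ext_iff] using h)
    refine Eq.trans ?_ (Matrix.det_updateRow_add_smul_self _ hne (C t))
    congr 1
    ext b a : 2
    by_cases hb : b = j'
    · subst hb
      have h1 : Fin.castLE hs j' = j := rfl
      have h2 : Fin.castLE hs i' = i := rfl
      simp [shear, h1, h2]
    · have h1 : Fin.castLE hs b ≠ j := by
        intro h
        have h2 : b.1 = j.1 := congrArg Fin.val h
        exact hb (Fin.ext h2)
      simp [shear, h1, hb]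
  · congr 1
    ext b a : 2
    have h1 : Fin.castLE hs b ≠ j := by
      rintro rfl
      exact hj b.2
    simp [shear, h1]

/-- The exponent of the product of the diagonal entries of a minor. -/
noncomputable def diagonalExponent (s : ℕ) (hs : s ≤ p) (r : Fin s → Fin k)
    (π : Equiv.Perm (Fin s)) : Fin p × Fin k →₀ ℕ :=
  ∑ a, Finsupp.single (Fin.castLE hs (π a), r a) 1

theorem diagonalExponent_apply (s : ℕ) (hs : s ≤ p) (r : Fin s → Fin k)
    (π : Equiv.Perm (Fin s)) (v : Fin p × Fin k) :
    diagonalExponent s hs r π v = ∑ a, if (Fin.castLE hs (π a), r a) = v then 1 else 0 := by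
  simp only [diagonalExponent, Finsupp.coe_finsetSum, Finset.sum_apply, Finsupp.single_apply]

theorem flagMinor_eq_sum (s : ℕ) (hs : s ≤ p) (r : Fin s → Fin k) :
    flagMinor s hs r = ∑ π : Equiv.Perm (Fin s),
      monomial (diagonalExponent s hs r π) ((Equiv.Perm.sign π : ℤ) : ℂ) := by
  rw [flagMinor, ← Matrix.det_transpose, Matrix.det_apply]
  refine Finset.sum_congr rfl fun π _ => ?_
  have : ∏ a, X (Fin.castLE hs (π a), r a) =
      (monomial (diagonalExponent s hs r π) 1 : MvPolynomial (Fin p × Fin k) ℂ) := by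
    rw [diagonalExponent, monomial_sum_one]
    rfl
  simp only [Matrix.transpose_apply, Matrix.of_apply, this, Units.smul_def]
  rw [← Int.cast_smul_eq_zsmul ℂ, smul_monomial, smul_eq_mul, mul_one]

theorem diagonalExponent_lt {s : ℕ} (hs : s ≤ p) {r : Fin s → Fin k} (hr : StrictMono r)
    {π : Equiv.Perm (Fin s)} (hπ : π ≠ 1) :
    (columnOrder p k).toSyn (diagonalExponent s hs r π) <
      (columnOrder p k).toSyn (diagonalExponent s hs r 1) := by
  classical
  -- the largest index that is moved
  obtain ⟨a, ha, hmax⟩ : ∃ a, π a ≠ a ∧ ∀ b, a < b → π b = b := by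
    have hne : (Finset.univ.filter fun a => π a ≠ a).Nonempty := by
      by_contra h
      rw [Finset.not_nonempty_iff_eq_empty, Finset.filter_eq_empty_iff] at h
      exact hπ (Equiv.ext fun a => by simpa using h (Finset.mem_univ a))
    refine ⟨Finset.max' _ hne, (Finset.mem_filter.1 (Finset.max'_mem _ hne)).2, fun b hb => ?_⟩
    by_contra h
    exact hb.not_ge (Finset.le_max' _ b (Finset.mem_filter.2 ⟨Finset.mem_univ _, h⟩))
  refine columnOrder_lt (Fin.castLE hs a, r a) ?_ ?_
  · rintro ⟨x, y⟩ hu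
    rw [diagonalExponent_apply, diagonalExponent_apply]
    refine Finset.sum_congr rfl fun b _ => ?_
    rcases lt_trichotomy a b with h | rfl | h
    · rw [hmax b h]; rfl
    · have h1 : (Fin.castLE hs (π a), r a) ≠ (x, y) := by
        intro h
        rw [Prod.mk.injEq] at h
        rcases hu with hu | hu
        · exact hu.ne h.2
        · have h2 : a < π a := by
            have := hu.2
            rw [← h.1] at this
            exact this
          exact ha (π.injective (hmax _ h2))
      have h2 : (Fin.castLE hs ((1 : Equiv.Perm (Fin s)) a), r a) ≠ (x, y) := by
        intro h
        rw [Prod.mk.injEq] at h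
        rcases hu with hu | hu
        · exact hu.ne h.2
        · exact hu.2.ne h.1
      rw [if_neg h1, if_neg h2]
    · have h1 : ∀ z : Fin p, (z, r b) ≠ (x, y) := by
        intro z h'
        rw [Prod.mk.injEq] at h'
        have h3 : y < r a := h'.2 ▸ hr h
        rcases hu with hu | hu
        · exact lt_asymm hu h3
        · exact h3.ne hu.1.symm
      rw [if_neg (h1 _), if_neg (h1 _)]
  · rw [diagonalExponent_apply, diagonalExponent_apply, Finset.sum_eq_zero]
    · refine Finset.sum_pos' (fun _ _ => Nat.zero_le _) ⟨a, Finset.mem_univ _, ?_⟩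
      simp
    · intro b _
      rw [if_neg]
      intro h
      rw [Prod.mk.injEq] at h
      have h1 := hr.injective h.2
      subst h1
      exact ha (Fin.castLE_injective hs h.1)

theorem flagMinor_ne_zero_and_degree {s : ℕ} (hs : s ≤ p) {r : Fin s → Fin k}
    (hr : StrictMono r) : flagMinor s hs r ≠ 0 ∧
      (columnOrder p k).degree (flagMinor s hs r) = diagonalExponent s hs r 1 := by
  classical
  have hc : coeff (diagonalExponent s hs r 1) (flagMinor s hs r) = 1 := by
    rw [flagMinor_eq_sum, coeff_sum, Finset.sum_eq_single 1]
    · simp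
    · intro π _ hπ
      rw [coeff_monomial, if_neg]
      intro h
      have := diagonalExponent_lt hs hr hπ
      rw [h] at this
      exact lt_irrefl _ this
    · simp
  have h0 : flagMinor s hs r ≠ 0 := by
    intro h
    rw [h, coeff_zero] at hc
    exact zero_ne_one hc
  refine ⟨h0, (columnOrder p k).toSyn.injective (le_antisymm ?_ ?_)⟩
  · rw [MonomialOrder.degree_le_iff]
    intro c hcs
    rw [mem_support_iff, flagMinor_eq_sum, coeff_sum] at hcs
    obtain ⟨π, -, hπ⟩ := Finset.exists_ne_zero_of_sum_ne_zero hcs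
    rw [coeff_monomial] at hπ
    have hπ' : diagonalExponent s hs r π = c := by
      by_contra h
      exact hπ (if_neg h)
    rw [← hπ']
    by_cases h1 : π = 1
    · rw [h1]
    · exact (diagonalExponent_lt hs hr h1).le
  · refine MonomialOrder.le_degree ?_
    rw [mem_support_iff, hc]
    exact one_ne_zero

/-- The algebra generated by the minors whose rows are the first ones. -/
noncomputable def flagAlgebra (p k : ℕ) : Subalgebra ℂ (MvPolynomial (Fin p × Fin k) ℂ) :=
  Algebra.adjoin ℂ {Q | ∃ (s : ℕ) (hs : s ≤ p) (r : Fin s → Fin k), StrictMono r ∧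
    Q = flagMinor s hs r}

/-- The exponents whose rows are the rows of a semistandard tableau with strictly increasing
columns. -/
def IsTableauExponent (d : Fin p × Fin k →₀ ℕ) : Prop :=
  ∀ i j : Fin p, i.1 + 1 = j.1 → ∀ l, ∑ x with x ≤ l, d (j, x) ≤ ∑ x with x < l, d (i, x)

/-- The columns of the tableau are the diagonals of the minors of a product of minors. -/
theorem IsTableauExponent.exists_mem_flagAlgebra {d : Fin p × Fin k →₀ ℕ}
    (hd : IsTableauExponent d) :
    ∃ Q ∈ flagAlgebra p k, Q ≠ 0 ∧ (columnOrder p k).degree Q = d := by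
  classical
  induction hn : d.degree using Nat.strong_induction_on generalizing d with
  | _ n ih =>
  subst hn
  by_cases hd0 : d = 0
  · exact ⟨1, one_mem _, one_ne_zero, by rw [MonomialOrder.degree_one, hd0]⟩
  -- the last nonzero row
  have hne : (Finset.univ.filter fun i : Fin p => ∃ x, d (i, x) ≠ 0).Nonempty := by
    by_contra h
    rw [Finset.not_nonempty_iff_eq_empty, Finset.filter_eq_empty_iff] at h
    refine hd0 (Finsupp.ext fun v => ?_)
    by_contra hv
    exact h (Finset.mem_univ v.1) ⟨v.2, hv⟩
  set i₀ := Finset.max' _ hne with hi₀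
  have hi₀' : ∃ x, d (i₀, x) ≠ 0 := (Finset.mem_filter.1 (Finset.max'_mem _ hne)).2
  have hlast : ∀ i, i₀ < i → ∀ x, d (i, x) = 0 := by
    intro i hi x
    by_contra h
    exact hi.not_ge (Finset.le_max' _ i (Finset.mem_filter.2 ⟨Finset.mem_univ _, x, h⟩))
  have hprev : ∀ i j : Fin p, i.1 + 1 = j.1 → ∀ x, d (j, x) ≠ 0 → ∃ y, y < x ∧ d (i, y) ≠ 0 := by
    intro i j hij x hx
    by_contra! h
    have h1 := hd i j hij x
    have h2 : ∑ y with y < x, d (i, y) = 0 :=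
      Finset.sum_eq_zero fun y hy => h y (Finset.mem_filter.1 hy).2
    rw [h2, Nat.le_zero, Finset.sum_eq_zero_iff] at h1
    exact hx (h1 x (by simp))
  have hrow : ∀ m : ℕ, ∀ i : Fin p, i.1 + m = i₀.1 → ∃ x, d (i, x) ≠ 0 := by
    intro m
    induction m with
    | zero =>
      intro i hi
      rwa [show i = i₀ from Fin.ext hi]
    | succ m ihm =>
      intro i hi
      have hlt : i.1 + 1 < p := by have := i₀.2; omega
      obtain ⟨x, hx⟩ := ihm ⟨i.1 + 1, hlt⟩ (by simp only; omega)
      obtain ⟨y, -, hy⟩ := hprev i ⟨i.1 + 1, hlt⟩ rfl x hx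
      exact ⟨y, hy⟩
  have hs : i₀.1 + 1 ≤ p := i₀.2
  have hfirst : ∀ a : Fin (i₀.1 + 1), ∃ x, d (Fin.castLE hs a, x) ≠ 0 ∧
      ∀ y, y < x → d (Fin.castLE hs a, y) = 0 := by
    intro a
    have hne' : (Finset.univ.filter fun x => d (Fin.castLE hs a, x) ≠ 0).Nonempty := by
      obtain ⟨x, hx⟩ := hrow (i₀.1 - a.1) (Fin.castLE hs a)
        (by have := a.2; simp only [Fin.val_castLE]; omega)
      exact ⟨x, by simpa using hx⟩
    refine ⟨Finset.min' _ hne', (Finset.mem_filter.1 (Finset.min'_mem _ hne')).2, fun y hy => ?_⟩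
    by_contra h
    exact hy.not_ge (Finset.min'_le _ y (by simpa using h))
  choose r hr1 hr2 using hfirst
  have hr : StrictMono r := by
    rw [Fin.strictMono_iff_lt_succ]
    intro a
    obtain ⟨y, hy, hy'⟩ := hprev (Fin.castLE hs a.castSucc) (Fin.castLE hs a.succ) rfl _ (hr1 a.succ)
    refine lt_of_le_of_lt ?_ hy
    by_contra h
    exact hy' (hr2 _ y (not_le.1 h))
  set D := diagonalExponent (i₀.1 + 1) hs r 1 with hD
  have hDapp : ∀ (a : Fin (i₀.1 + 1)) x, D (Fin.castLE hs a, x) = if x = r a then 1 else 0 := by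
    intro a x
    rw [hD, diagonalExponent_apply, Finset.sum_eq_single a]
    · simp [eq_comm]
    · intro b _ hb
      rw [if_neg]
      intro h
      rw [Prod.mk.injEq] at h
      exact hb (Fin.castLE_injective hs h.1)
    · simp
  have hDfar : ∀ i, i₀ < i → ∀ x, D (i, x) = 0 := by
    intro i hi x
    rw [hD, diagonalExponent_apply]
    refine Finset.sum_eq_zero fun b _ => if_neg fun h => ?_
    rw [Prod.mk.injEq] at h
    have h1 : b.1 = i.1 := congrArg Fin.val h.1
    have := b.2
    have : i₀.1 < i.1 := hi
    omega
  have hcast : ∀ i : Fin p, i ≤ i₀ → ∃ a : Fin (i₀.1 + 1), Fin.castLE hs a = i := fun i hi =>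
    ⟨⟨i.1, Nat.lt_succ_of_le hi⟩, rfl⟩
  have hle : D ≤ d := by
    rintro ⟨i, x⟩
    rcases le_or_gt i i₀ with hi | hi
    · obtain ⟨a, rfl⟩ := hcast i hi
      rw [hDapp]
      split_ifs with h
      · rw [h]
        exact Nat.one_le_iff_ne_zero.2 (hr1 a)
      · exact Nat.zero_le _
    · rw [hDfar i hi]
      exact Nat.zero_le _
  obtain ⟨d', hd'⟩ : ∃ d', d = d' + D := ⟨d - D, (tsub_add_cancel_of_le hle).symm⟩
  have hlad : IsTableauExponent d' := by
    intro i j hij l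
    have h1 := hd i j hij l
    simp only [hd', Finsupp.add_apply, Finset.sum_add_distrib] at h1
    rcases le_or_gt j i₀ with hj | hj
    · obtain ⟨b, rfl⟩ := hcast j hj
      obtain ⟨a, rfl⟩ := hcast i (by
        rw [Fin.le_def] at hj ⊢
        omega)
      simp only [hDapp, Finset.sum_ite_eq', Finset.mem_filter, Finset.mem_univ, true_and] at h1
      have hab : a < b := by
        rw [Fin.lt_def]
        simp only [Fin.val_castLE] at hij
        omega
      rcases le_or_gt (r b) l with hl | hl
      · rw [if_pos hl, if_pos ((hr hab).trans_le hl)] at h1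
        omega
      · have h2 : ∑ x with x ≤ l, d' (Fin.castLE hs b, x) = 0 := by
          refine Finset.sum_eq_zero fun x hx => ?_
          have h3 := hr2 b x ((Finset.mem_filter.1 hx).2.trans_lt hl)
          rw [hd', Finsupp.add_apply] at h3
          omega
        omega
    · have h2 : ∑ x with x ≤ l, d' (j, x) = 0 := by
        refine Finset.sum_eq_zero fun x _ => ?_
        have h3 := hlast j hj x
        rw [hd', Finsupp.add_apply] at h3
        omega
      omega
  have hdeg : d'.degree < d.degree := by
    rw [hd', map_add]
    have : D ≠ 0 := by
      intro h
      have := hDapp (Fin.last _) (r (Fin.last _))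
      rw [h] at this
      simp at this
    have := (Finsupp.degree_eq_zero_iff D).not.2 this
    omega
  obtain ⟨Q, hQ, hQ0, hQd⟩ := ih _ hdeg hlad rfl
  obtain ⟨hm0, hmd⟩ := flagMinor_ne_zero_and_degree hs hr
  refine ⟨Q * flagMinor _ hs r, mul_mem hQ (Algebra.subset_adjoin ⟨_, hs, r, hr, rfl⟩),
    mul_ne_zero hQ0 hm0, ?_⟩
  rw [MonomialOrder.degree_mul hQ0 hm0, hQd, hmd, hd']

/-- The first fundamental theorem of invariant theory for the group of unipotent triangular
matrices: its invariants are the polynomials in the minors whose rows are the first ones. -/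
theorem mem_flagAlgebra_of_shear {P : MvPolynomial (Fin p × Fin k) ℂ}
    (hP : ∀ i j : Fin p, i < j → ∀ t, shear i j t P = P) : P ∈ flagAlgebra p k := by
  classical
  induction hd : (columnOrder p k).toSyn ((columnOrder p k).degree P) using
    WellFoundedLT.induction generalizing P with
  | _ d ih =>
  subst hd
  by_cases hP0 : P = 0
  · rw [hP0]
    exact zero_mem _
  have hlad : IsTableauExponent ((columnOrder p k).degree P) := by
    intro i j hij l
    have hlt : i < j := by rw [Fin.lt_def]; omega
    exact sum_row_le_of_polarization_eq_zero hlt hP0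
      (polarization_eq_zero_of_shear hlt.ne (hP i j hlt)) l
  obtain ⟨Q, hQ, hQ0, hQd⟩ := hlad.exists_mem_flagAlgebra
  have hQinv : ∀ i j : Fin p, i < j → ∀ t, shear i j t Q = Q := by
    intro i j hij t
    have : flagAlgebra p k ≤ AlgHom.equalizer (shear i j t) (AlgHom.id ℂ _) := by
      refine Algebra.adjoin_le ?_
      rintro _ ⟨s, hs, r, -, rfl⟩
      exact shear_flagMinor hij t s hs r
    exact this hQ
  set c := (columnOrder p k).leadingCoeff P / (columnOrder p k).leadingCoeff Q with hc
  have hmem : P - c • Q ∈ flagAlgebra p k := by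
    by_cases h0 : P - c • Q = 0
    · rw [h0]
      exact zero_mem _
    refine ih _ ?_ (fun i j hij t => by rw [map_sub, map_smul, hP i j hij, hQinv i j hij]) rfl
    refine lt_of_le_of_ne ?_ fun h => ?_
    · refine MonomialOrder.degree_sub_le.trans (max_le le_rfl ?_)
      exact MonomialOrder.degree_smul_le.trans (by rw [hQd])
    · have h1 := (columnOrder p k).toSyn.injective h
      refine (columnOrder p k).coeff_degree_ne_zero_iff.2 h0 ?_
      rw [h1, coeff_sub, coeff_smul, smul_eq_mul]
      conv_lhs => rw [← hQd]
      rw [← MonomialOrder.leadingCoeff, hQd, ← MonomialOrder.leadingCoeff, hc, div_mul_cancel₀,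
        sub_self]
      exact MonomialOrder.leadingCoeff_ne_zero_iff.2 hQ0
  have := add_mem hmem (Subalgebra.smul_mem _ hQ c)
  rwa [sub_add_cancel] at this

end FlagMinorsGenerate

/-! ### Straightening the first component of a jet -/

section Jets

open Filter Topology

variable {n : ℕ}

/-- The evaluation of jet polynomials along the polynomial map `f`, as a function of the point of
the source. -/
noncomputable def jetMap (f : Fin n → Polynomial ℂ) : JetRing n →ₐ[ℂ] Polynomial ℂ :=
  aeval fun p => Polynomial.derivative^[p.2] (f p.1)

theorem jetMap_X (f : Fin n → Polynomial ℂ) (p : Fin n × ℕ) :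
    jetMap f (X p) = Polynomial.derivative^[p.2] (f p.1) := by
  simp [jetMap]

theorem totalD_X (p : Fin n × ℕ) : totalD n (X p) = X (p.1, p.2 + 1) :=
  mkDerivation_X _ _ _

theorem derivative_jetMap (f : Fin n → Polynomial ℂ) (P : JetRing n) :
    Polynomial.derivative (jetMap f P) = jetMap f (totalD n P) := by
  refine derivative_algHom _ _ (fun p => ?_) P
  rw [totalD_X, jetMap_X, jetMap_X, Function.iterate_succ_apply']

theorem iteratedDeriv_polynomial_eval (q : Polynomial ℂ) (l : ℕ) :
    iteratedDeriv l (fun z => q.eval z) = fun z => (Polynomial.derivative^[l] q).eval z := by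
  induction l with
  | zero => rw [iteratedDeriv_zero]; rfl
  | succ l ih =>
    rw [iteratedDeriv_succ, ih, Function.iterate_succ_apply']
    funext z
    exact Polynomial.deriv _

theorem eval_eq_of_mem_supported {σ : Type*} {s : Set σ} {P : MvPolynomial σ ℂ}
    (hP : P ∈ supported ℂ s) {x y : σ → ℂ} (h : ∀ v ∈ s, x v = y v) : eval x P = eval y P :=
  eval₂Hom_congr' rfl (fun v hv _ => h v (mem_supported.1 hP hv)) rfl

theorem eval_jetAt (f : Fin n → Polynomial ℂ) (P : JetRing n) :
    eval (jetAt fun i z => (f i).eval z) P = (jetMap f P).eval 0 := by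
  have : ((Polynomial.aeval (0 : ℂ)).comp (jetMap f)) =
      aeval (jetAt fun i z => (f i).eval z) := by
    ext p
    simp [jetMap_X, jetAt, iteratedDeriv_polynomial_eval]
  have h := DFunLike.congr_fun this P
  rw [AlgHom.comp_apply, Polynomial.coe_aeval_eq_eval] at h
  exact h.symm

theorem eval_matrixAction (w : Matrix (Fin n) (Fin n) ℂ) (x : Fin n × ℕ → ℂ) (P : JetRing n) :
    eval x (matrixAction w P) = eval (fun p => ∑ j, w p.1 j * x (j, p.2)) P := by
  have : ((aeval x : JetRing n →ₐ[ℂ] ℂ).comp (matrixAction w)) =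
      aeval (fun p => ∑ j, w p.1 j * x (j, p.2)) := by
    ext p
    simp [matrixAction]
  exact DFunLike.congr_fun this P

/-- Jet polynomials are determined by their values on the jets of polynomial maps. -/
theorem eq_of_forall_jetMap [NeZero n] {A B : JetRing n}
    (h : ∀ f : Fin n → Polynomial ℂ, (Polynomial.derivative (f 0)).eval 0 ≠ 0 →
      (jetMap f A).eval 0 = (jetMap f B).eval 0) : A = B := by
  have key : f1' n * A = f1' n * B := by
    refine MvPolynomial.funext fun x => ?_
    by_cases hx : x (0, 1) = 0
    · simp [f1', hx]
    classical
    let K : ℕ := max 1 (((f1' n * A).vars ∪ (f1' n * B).vars).sup Prod.snd)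
    let f : Fin n → Polynomial ℂ := fun i =>
      ∑ l ∈ Finset.range (K + 1), Polynomial.monomial l (x (i, l) / (l.factorial : ℂ))
    have hf : ∀ p : Fin n × ℕ, p.2 ≤ K →
        (Polynomial.derivative^[p.2] (f p.1)).eval 0 = x p := by
      rintro ⟨i, l⟩ hl
      rw [← Polynomial.coeff_zero_eq_eval_zero, Polynomial.coeff_iterate_derivative, zero_add,
        Nat.descFactorial_self, Polynomial.finsetSum_coeff, Finset.sum_eq_single l]
      · rw [Polynomial.coeff_monomial, if_pos rfl, nsmul_eq_mul]
        exact mul_div_cancel₀ _ (by exact_mod_cast l.factorial_ne_zero)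
      · intro b _ hb
        rw [Polynomial.coeff_monomial, if_neg hb]
      · intro hl'
        exact absurd (Finset.mem_range.2 (Nat.lt_succ_of_le hl)) hl'
    have hev : ∀ Q : JetRing n, (∀ p ∈ Q.vars, p.2 ≤ K) → eval x Q = (jetMap f Q).eval 0 := by
      intro Q hQ
      rw [← eval_jetAt]
      refine eval₂Hom_congr' rfl (fun p hp _ => ?_) rfl
      rw [jetAt, iteratedDeriv_polynomial_eval]
      exact (hf p (hQ p hp)).symm
    have h1 := h f (by
      have := hf (0, 1) (le_max_left _ _)
      rw [Function.iterate_one] at this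
      rwa [this])
    rw [hev, hev, map_mul, map_mul, Polynomial.eval_mul, Polynomial.eval_mul, h1]
    · exact fun p hp => le_max_of_le_right
        (Finset.le_sup (f := Prod.snd) (Finset.mem_union_right _ hp))
    · exact fun p hp => le_max_of_le_right
        (Finset.le_sup (f := Prod.snd) (Finset.mem_union_left _ hp))
  exact mul_left_cancel₀ (X_ne_zero _) key

theorem exists_local_inverse (q : Polynomial ℂ) (hq : (Polynomial.derivative q).eval 0 ≠ 0) :
    ∃ φ : ℂ → ℂ, AnalyticAt ℂ φ 0 ∧ φ 0 = 0 ∧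
      ∀ᶠ z in 𝓝 0, (Polynomial.derivative q).eval (φ z) ≠ 0 ∧
        HasDerivAt φ ((Polynomial.derivative q).eval (φ z))⁻¹ z := by
  let g : ℂ → ℂ := fun z => (q - Polynomial.C (q.eval 0)).eval z
  have hgd : ∀ z, HasDerivAt g ((Polynomial.derivative q).eval z) z := fun z => by
    have := (q - Polynomial.C (q.eval 0)).hasDerivAt z
    rwa [Polynomial.derivative_sub, Polynomial.derivative_C, sub_zero] at this
  have hga : AnalyticAt ℂ g 0 := (Polynomial.differentiable _).analyticAt 0
  have hg0 : g 0 = 0 := by simp [g]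
  have hd : deriv g 0 ≠ 0 := by rwa [(hgd 0).deriv]
  have h1 := hga.analyticAt_localInverse hd
  have h2 := HasStrictDerivAt.eventually_right_inverse hga.hasStrictDerivAt hd
  set φ := HasStrictDerivAt.localInverse g (deriv g 0) 0 hga.hasStrictDerivAt hd with hφ
  have h0 : φ (g 0) = 0 := HasStrictFDerivAt.localInverse_apply_image _
  rw [hg0] at h0 h1 h2
  refine ⟨φ, h1, h0, ?_⟩
  have h3 : ∀ᶠ z in 𝓝 (0 : ℂ), (Polynomial.derivative q).eval (φ z) ≠ 0 := by
    have hc : ContinuousAt (fun z => (Polynomial.derivative q).eval (φ z)) 0 :=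
      (Polynomial.derivative q).continuous.continuousAt.comp h1.continuousAt
    refine hc.eventually_ne ?_
    rwa [h0]
  filter_upwards [h3, h1.eventually_analyticAt, eventually_eventually_nhds.2 h2] with z hz1 hz2 hz3
  refine ⟨hz1, ?_⟩
  have h4 := hz2.differentiableAt.hasDerivAt
  have h5 : HasDerivAt (fun w => g (φ w)) _ z := (hgd (φ z)).comp z h4
  have h6 : HasDerivAt (fun w => g (φ w)) 1 z := (hasDerivAt_id z).congr_of_eventuallyEq hz3
  have h7 := h5.unique h6
  rwa [eq_inv_of_mul_eq_one_right h7] at h4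

variable [NeZero n]

theorem initialLambda_zero (r : ℕ) : initialLambda (0 : Fin n) r = 0 := by
  induction r with
  | zero => simp only [initialLambda, bracket, f1']; ring
  | succ r ih => simp [initialLambda, bracket, ih]

theorem deriv_jetMap_div (f : Fin n → Polynomial ℂ) {φ : ℂ → ℂ} {z : ℂ}
    (h0 : (Polynomial.derivative (f 0)).eval (φ z) ≠ 0)
    (h1 : HasDerivAt φ ((Polynomial.derivative (f 0)).eval (φ z))⁻¹ z) (P : JetRing n) (N : ℕ) :
    deriv (fun w => (jetMap f P).eval (φ w) / (Polynomial.derivative (f 0)).eval (φ w) ^ N) z =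
      (jetMap f (bracket N P 1 (f1' n))).eval (φ z) /
        (Polynomial.derivative (f 0)).eval (φ z) ^ (N + 2) := by
  have hP := ((jetMap f P).hasDerivAt (φ z)).comp z h1
  have hQ := ((Polynomial.derivative (f 0)).hasDerivAt (φ z)).comp z h1
  have := (hP.div (hQ.pow N) (pow_ne_zero N h0)).deriv
  refine this.trans ?_
  have hX : jetMap f (f1' n) = Polynomial.derivative (f 0) := by
    rw [f1', jetMap_X, Function.iterate_one]
  simp only [bracket, map_sub, map_mul, map_natCast, ← derivative_jetMap, hX, Polynomial.eval_sub,
    Polynomial.eval_mul, Polynomial.eval_natCast, Function.comp_apply, Nat.cast_one, one_mul,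
    Pi.pow_apply]
  rcases N with _ | N
  · field_simp
    simp
    ring
  · rw [Nat.add_sub_cancel]
    field_simp
    ring

/-- The jets of `f ∘ φ`, where `φ` is the inverse of the first component of `f`, are the quotients
of the initial bi-invariants by powers of `f_1'`. -/
theorem iteratedDeriv_comp_inverse (f : Fin n → Polynomial ℂ) {φ : ℂ → ℂ}
    (hφ : ∀ᶠ z in 𝓝 0, (Polynomial.derivative (f 0)).eval (φ z) ≠ 0 ∧
        HasDerivAt φ ((Polynomial.derivative (f 0)).eval (φ z))⁻¹ z) (i : Fin n) :
    iteratedDeriv 1 ((fun z => (f i).eval z) ∘ φ) =ᶠ[𝓝 0] (fun z =>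
        (jetMap f (X (i, 1))).eval (φ z) / (Polynomial.derivative (f 0)).eval (φ z) ^ 1) ∧
      ∀ r, iteratedDeriv (r + 2) ((fun z => (f i).eval z) ∘ φ) =ᶠ[𝓝 0] fun z =>
        (jetMap f (initialLambda i r)).eval (φ z) /
          (Polynomial.derivative (f 0)).eval (φ z) ^ (2 * r + 3) := by
  have h1 : iteratedDeriv 1 ((fun z => (f i).eval z) ∘ φ) =ᶠ[𝓝 0] (fun z =>
      (jetMap f (X (i, 1))).eval (φ z) / (Polynomial.derivative (f 0)).eval (φ z) ^ 1) := by
    filter_upwards [hφ] with z hz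
    rw [iteratedDeriv_one, (((f i).hasDerivAt (φ z)).comp z hz.2).deriv, jetMap_X,
      Function.iterate_one, pow_one, div_eq_mul_inv]
  refine ⟨h1, fun r => ?_⟩
  induction r with
  | zero =>
    rw [zero_add, iteratedDeriv_succ]
    refine h1.deriv.trans ?_
    filter_upwards [hφ] with z hz
    rw [deriv_jetMap_div f hz.1 hz.2]
    rfl
  | succ r ih =>
    rw [show r + 1 + 2 = r + 2 + 1 from rfl, iteratedDeriv_succ]
    refine ih.deriv.trans ?_
    filter_upwards [hφ] with z hz
    rw [deriv_jetMap_div f hz.1 hz.2]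
    rfl

/-- The jet of a representative of the orbit of the jet of `f` for which `f_1 = z + O(z^{κ+1})` and
`f_2' = ⋯ = f_n' = 0`. -/
noncomputable def slicePoint (f : Fin n → Polynomial ℂ) : Fin n × ℕ → ℂ := fun p =>
  if p.1 = 0 then if p.2 = 1 then 1 else 0
  else if p.2 = 1 then 0
  else (jetMap f (initialLambda p.1 (p.2 - 2))).eval 0 /
    (Polynomial.derivative (f 0)).eval 0 ^ (2 * (p.2 - 2) + 3)

theorem eval_eq_slicePoint {κ m : ℕ} {P : JetRing n} (hP : P ∈ UEwt n κ m)
    (f : Fin n → Polynomial ℂ) (hf : (Polynomial.derivative (f 0)).eval 0 ≠ 0) :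
    (jetMap f P).eval 0 = (Polynomial.derivative (f 0)).eval 0 ^ m * eval (slicePoint f) P := by
  obtain ⟨⟨hPs, hPr⟩, hPu⟩ := hP
  obtain ⟨φ, hφa, hφ0, hφ⟩ := exists_local_inverse (f 0) hf
  have hder : deriv φ 0 = ((Polynomial.derivative (f 0)).eval 0)⁻¹ := by
    have := hφ.self_of_nhds.2.deriv
    rwa [hφ0] at this
  have h1 := hPr (fun i z => (f i).eval z) φ (fun i => (Polynomial.differentiable _).analyticAt 0) hφa hφ0
    (by rw [hder]; exact inv_ne_zero hf)
  rw [eval_jetAt, hder, inv_pow] at h1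
  set g := jetAt fun i => (fun z => (f i).eval z) ∘ φ with hg
  have hg1 : ∀ i, g (i, 1) = (jetMap f (X (i, 1))).eval 0 /
      (Polynomial.derivative (f 0)).eval 0 ^ 1 := by
    intro i
    have := (iteratedDeriv_comp_inverse f hφ i).1.self_of_nhds
    simp only [hφ0] at this
    exact this
  have hg2 : ∀ i r, g (i, r + 2) = (jetMap f (initialLambda i r)).eval 0 /
      (Polynomial.derivative (f 0)).eval 0 ^ (2 * r + 3) := by
    intro i r
    have := ((iteratedDeriv_comp_inverse f hφ i).2 r).self_of_nhds
    simp only [hφ0] at this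
    exact this
  have hg01 : g (0, 1) = 1 := by
    rw [hg1, jetMap_X, pow_one, Function.iterate_one, div_self hf]
  have hg0 : ∀ r, g (0, r + 2) = 0 := by
    intro r
    rw [hg2, initialLambda_zero, map_zero, Polynomial.eval_zero, zero_div]
  -- the unipotent matrix that annihilates the first derivatives of the other components
  let u : Matrix (Fin n) (Fin n) ℂ := fun i j =>
    if i = j then 1 else if j = 0 then -g (i, 1) else 0
  have hu : IsUnipotent u := by
    refine ⟨fun i => if_pos rfl, fun i j hij => ?_⟩
    have hj : j ≠ 0 := fun h => by
      rw [h, Fin.lt_def] at hij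
      exact Nat.not_lt_zero _ hij
    simp [u, hij.ne, hj]
  have hsum : ∀ i l, ∑ j, u i j * g (j, l) =
      if i = 0 then g (0, l) else g (i, l) - g (i, 1) * g (0, l) := by
    intro i l
    split_ifs with hi
    · rw [Finset.sum_eq_single i]
      · simp [u, hi]
      · intro j _ hj
        have : j ≠ 0 := hi ▸ hj
        simp [u, hj.symm, this]
      · simp
    · rw [Finset.sum_eq_add i 0 hi]
      · simp [u, hi]
        ring
      · intro j _ hj
        simp [u, hj.1.symm, hj.2]
      · simp
      · simp
  have h2 : eval g P = eval (slicePoint f) P := by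
    conv_lhs => rw [← hPu u hu, eval_matrixAction]
    refine eval_eq_of_mem_supported hPs ?_
    rintro ⟨i, l⟩ ⟨hl, -⟩
    dsimp only at hl ⊢
    rw [hsum]
    obtain rfl | ⟨r, rfl⟩ : l = 1 ∨ ∃ r, l = r + 2 := by
      rcases Nat.lt_or_ge l 2 with h | h
      · left; omega
      · right; exact ⟨l - 2, by omega⟩
    · simp only [slicePoint, hg01, if_true, mul_one, sub_self]
    · have hne : r + 2 ≠ 1 := by omega
      simp only [slicePoint, hg0, mul_zero, sub_zero, if_neg hne, Nat.add_sub_cancel, hg2]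
  rw [← h2, h1, mul_inv_cancel_left₀ (pow_ne_zero m hf)]

end Jets

/-! ### Weights of bi-invariants -/

section Weights

variable {n : ℕ}

/-- The substitution `f_i^{(l)} ↦ 2^l f_i^{(l)}`, induced by the reparametrization `z ↦ 2 z`. -/
noncomputable def dilation (n : ℕ) : JetRing n →ₐ[ℂ] JetRing n :=
  aeval fun p => C ((2 : ℂ) ^ p.2) * X p

theorem coeff_dilation (P : JetRing n) (d : Fin n × ℕ →₀ ℕ) :
    coeff d (dilation n P) = 2 ^ Finsupp.weight (Prod.snd : Fin n × ℕ → ℕ) d * coeff d P := by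
  induction P using MvPolynomial.induction_on' with
  | monomial e c =>
    have : dilation n (monomial e c) =
        monomial e (2 ^ Finsupp.weight (Prod.snd : Fin n × ℕ → ℕ) e * c) := by
      rw [dilation, aeval_monomial, algebraMap_eq, Finsupp.weight_apply, mul_comm ((2 : ℂ) ^ _),
        ← C_mul_monomial, monomial_eq (a := (2 : ℂ) ^ _)]
      simp only [mul_pow, Finsupp.sum, Finsupp.prod, ← Finset.prod_pow_eq_pow_sum,
        map_prod, ← map_pow, ← pow_mul, smul_eq_mul]
      simp only [mul_comm, Finset.prod_mul_distrib]
    rw [this, coeff_monomial, coeff_monomial]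
    split_ifs with h
    · rw [h]
    · rw [mul_zero]
  | add p q hp hq => rw [map_add, coeff_add, coeff_add, hp, hq, mul_add]

theorem isWeightedHomogeneous_of_dilation {P : JetRing n} {m : ℕ}
    (h : dilation n P = C ((2 : ℂ) ^ m) * P) : IsWeightedHomogeneous Prod.snd P m := by
  intro d hd
  have h1 := coeff_dilation P d
  rw [h, coeff_C_mul] at h1
  have h2 := mul_right_cancel₀ hd h1
  exact (Nat.pow_right_injective le_rfl (by exact_mod_cast h2)).symm

theorem totalD_dilation (P : JetRing n) :
    dilation n (totalD n P) = C 2 * totalD n (dilation n P) := by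
  induction P using MvPolynomial.induction_on with
  | C a => simp [dilation, ← algebraMap_eq]
  | add p q hp hq => simp only [map_add, hp, hq, mul_add]
  | mul_X p v hp =>
    have hX : dilation n (totalD n (X v)) = C 2 * totalD n (dilation n (X v)) := by
      simp only [totalD_X, dilation, aeval_X, Derivation.leibniz, smul_eq_mul]
      rw [← algebraMap_eq, Derivation.map_algebraMap, mul_zero, add_zero, pow_succ, map_mul]
      ring
    simp only [Derivation.leibniz, map_add, map_mul, smul_eq_mul, hp, hX]
    ring

theorem isWeightedHomogeneous_of_mem_UEwt [NeZero n] {κ m : ℕ} {P : JetRing n}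
    (hP : P ∈ UEwt n κ m) : IsWeightedHomogeneous Prod.snd P m := by
  refine isWeightedHomogeneous_of_dilation (eq_of_forall_jetMap fun f _ => ?_)
  have h1 := hP.1.2 (fun i z => (f i).eval z) (fun z => 2 * z)
    (fun i => (Polynomial.differentiable _).analyticAt 0) (analyticAt_const.mul analyticAt_id)
    (mul_zero 2) (by simp)
  have h2 : ∀ Q : JetRing n, eval (jetAt fun i => (fun z => (f i).eval z) ∘ fun z => 2 * z) Q =
      eval (jetAt fun i z => (f i).eval z) (dilation n Q) := by
    intro Q
    have : (aeval (jetAt fun i => (fun z => (f i).eval z) ∘ fun z => 2 * z) : JetRing n →ₐ[ℂ] ℂ) =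
        (aeval (jetAt fun i z => (f i).eval z)).comp (dilation n) := by
      ext p
      have h3 : iteratedDeriv p.2 (fun z : ℂ => (f p.1).eval (2 * z)) =
          fun z => 2 ^ p.2 * iteratedDeriv p.2 (fun z => (f p.1).eval z) (2 * z) :=
        iteratedDeriv_comp_const_mul (Polynomial.differentiable (f p.1)).contDiff 2
      simp [dilation, jetAt, Function.comp_def, h3]
    exact DFunLike.congr_fun this Q
  have h3 : deriv (fun z : ℂ => 2 * z) 0 = 2 := by simp
  rw [h2, h3, eval_jetAt, eval_jetAt] at h1
  rw [h1, map_mul, Polynomial.eval_mul, ← algebraMap_eq, AlgHom.commutes]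
  simp

variable [NeZero n]

theorem dilation_f1' : dilation n (f1' n) = C 2 * f1' n := by
  simp [dilation, f1']

theorem dilation_initialLambda (i : Fin n) (r : ℕ) :
    dilation n (initialLambda i r) = C ((2 : ℂ) ^ (2 * r + 3)) * initialLambda i r := by
  have hC : ∀ (a : ℂ) (P : JetRing n), totalD n (C a * P) = C a * totalD n P := by
    intro a P
    rw [Derivation.leibniz, ← algebraMap_eq, Derivation.map_algebraMap, smul_zero, add_zero,
      smul_eq_mul]
  have hb : ∀ (P : JetRing n) (N M : ℕ), dilation n P = C ((2 : ℂ) ^ N) * P →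
      dilation n (bracket M P 1 (f1' n)) = C ((2 : ℂ) ^ (N + 2)) * bracket M P 1 (f1' n) := by
    intro P N M hP
    simp only [bracket, map_sub, map_mul, map_natCast, totalD_dilation, hP, dilation_f1', hC,
      pow_add, pow_two]
    ring
  induction r with
  | zero => exact hb _ 1 1 (by simp [dilation])
  | succ r ih => exact hb _ _ _ ih

theorem isWeightedHomogeneous_lambdaMinor (p : ℕ) (hp : p < n) (r : Fin p → ℕ) :
    IsWeightedHomogeneous Prod.snd (lambdaMinor p hp r) (∑ a, (2 * r a + 3)) := by
  refine isWeightedHomogeneous_of_dilation ?_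
  rw [lambdaMinor, AlgHom.map_det, ← Finset.prod_pow_eq_pow_sum, map_prod,
    ← Matrix.det_mul_column]
  congr 1
  ext a b : 2
  simp [dilation_initialLambda]

theorem le_of_isWeightedHomogeneous_f1'_pow_mul {ν W : ℕ} {R : JetRing n}
    (h : IsWeightedHomogeneous Prod.snd (f1' n ^ ν * R) W) (hR : R ≠ 0) : ν ≤ W := by
  obtain ⟨d, hd⟩ := ne_zero_iff.1 hR
  have h1 : coeff (Finsupp.single (0, 1) ν + d) (f1' n ^ ν * R) ≠ 0 := by
    rwa [f1', X_pow_eq_monomial, coeff_monomial_mul, one_mul]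
  have h2 := h h1
  rw [map_add, Finsupp.weight_apply, Finsupp.sum_single_index (by simp)] at h2
  simp only [smul_eq_mul, mul_one] at h2
  omega

theorem prime_f1' : Prime (f1' n) := X_prime

theorem lambdaMinor_mem {κ : ℕ} {𝒜 : Subalgebra ℂ (JetRing n)} (hf : f1' n ∈ 𝒜)
    (hinit : ∀ l L, IsInitial κ l L → L ∈ 𝒜) (p : ℕ) (hp : p < n) (r : Fin p → ℕ)
    (hr : StrictMono r) (hκ : ∀ a, r a + 2 ≤ κ) : lambdaMinor p hp r ∈ 𝒜 := by
  rcases Nat.eq_zero_or_pos p with rfl | hp0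
  · rw [lambdaMinor, Matrix.det_fin_zero]
    exact one_mem _
  by_cases h0 : lambdaMinor p hp r = 0
  · rw [h0]
    exact zero_mem _
  obtain ⟨ν, R, hR, hν⟩ := WfDvdMonoid.max_power_factor h0 (prime_f1' (n := n)).irreducible
  have hR0 : R ≠ 0 := fun h => hR (h ▸ dvd_zero _)
  have hle : ν ≤ ∑ a, (2 * r a + 3) := by
    have := isWeightedHomogeneous_lambdaMinor p hp r
    rw [hν] at this
    exact le_of_isWeightedHomogeneous_f1'_pow_mul this hR0
  rw [hν]
  exact mul_mem (pow_mem hf _) (hinit (∑ a, (2 * r a + 3) - ν) R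
    ⟨p, hp, r, ν, hp0, hr, hκ, ⟨hν, hR⟩, (Nat.sub_add_cancel hle).symm⟩)

end Weights

/-! ### Restriction to the slice -/

section Slice

variable {n : ℕ} [NeZero n]

theorem succ_val_lt {n : ℕ} (i : Fin (n - 1)) : i.1 + 1 < n := by
  have := i.2
  omega

/-- The restriction of jet polynomials to the slice `f_1 = z`, `f_2' = ⋯ = f_n' = 0`; the variable
of index `(i, r)` stands for `f_{i+2}^{(r+2)}`. -/
noncomputable def slice (n κ : ℕ) : JetRing n →ₐ[ℂ] MvPolynomial (Fin (n - 1) × Fin (κ - 1)) ℂ :=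
  aeval fun p =>
    if h : 1 ≤ p.1.1 ∧ 2 ≤ p.2 ∧ p.2 ≤ κ then
      X (⟨p.1.1 - 1, by have := p.1.2; omega⟩, ⟨p.2 - 2, by omega⟩)
    else if p.1.1 = 0 ∧ p.2 = 1 then 1 else 0

theorem slice_X_succ (n κ : ℕ) (i : Fin (n - 1)) (r : Fin (κ - 1)) :
    slice n κ (X (⟨i.1 + 1, succ_val_lt i⟩, r.1 + 2)) = X (i, r) := by
  have h : 1 ≤ i.1 + 1 ∧ 2 ≤ r.1 + 2 ∧ r.1 + 2 ≤ κ := by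
    have := r.2
    omega
  simp only [slice, aeval_X]
  rw [dif_pos h]
  rfl

theorem slice_X_of_not (n κ : ℕ) (p : Fin n × ℕ) (h : ¬ (1 ≤ p.1.1 ∧ 2 ≤ p.2 ∧ p.2 ≤ κ)) :
    slice n κ (X p) = if p.1.1 = 0 ∧ p.2 = 1 then 1 else 0 := by
  simp only [slice, aeval_X]
  rw [dif_neg h]

theorem exists_eq_slice_index {κ : ℕ} (p : Fin n × ℕ) (h : 1 ≤ p.1.1 ∧ 2 ≤ p.2 ∧ p.2 ≤ κ) :
    ∃ (i : Fin (n - 1)) (r : Fin (κ - 1)), p = (⟨i.1 + 1, succ_val_lt i⟩, r.1 + 2) := by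
  obtain ⟨⟨i, hi⟩, l⟩ := p
  dsimp only at h
  refine ⟨⟨i - 1, by omega⟩, ⟨l - 2, by omega⟩, ?_⟩
  simp only [Prod.mk.injEq, Fin.mk.injEq]
  omega

theorem shear_slice {κ : ℕ} {P : JetRing n} (hP : P ∈ unipotentInvariants n) {i j : Fin (n - 1)}
    (hij : i < j) (t : ℂ) : shear i j t (slice n κ P) = slice n κ P := by
  let i' : Fin n := ⟨i.1 + 1, succ_val_lt i⟩
  let j' : Fin n := ⟨j.1 + 1, succ_val_lt j⟩
  have hij' : i' < j' := Nat.succ_lt_succ hij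
  let u : Matrix (Fin n) (Fin n) ℂ := fun a b =>
    (if a = b then 1 else 0) + if a = j' ∧ b = i' then t else 0
  have hu : IsUnipotent u := by
    refine ⟨fun a => ?_, fun a b hab => ?_⟩
    · have : ¬ (a = j' ∧ a = i') := fun h => hij'.ne (h.2.symm.trans h.1)
      simp only [u, if_true, if_neg this, add_zero]
    · have : ¬ (a = j' ∧ b = i') := fun h => by
        rw [h.1, h.2] at hab
        exact lt_asymm hab hij'
      simp only [u, if_neg hab.ne, if_neg this, add_zero]
  have hact : ∀ p : Fin n × ℕ, matrixAction u (X p) =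
      X p + if p.1 = j' then C t * X (i', p.2) else 0 := by
    intro p
    simp only [matrixAction, aeval_X, u, map_add, add_mul, Finset.sum_add_distrib]
    congr 1
    · rw [Finset.sum_eq_single p.1]
      · simp
      · intro b _ hb
        simp [hb.symm]
      · simp
    · rw [Finset.sum_eq_single i']
      · by_cases h : p.1 = j' <;> simp [h]
      · intro b _ hb
        simp [hb]
      · simp
  have hcomp : (shear i j t).comp (slice n κ) = (slice n κ).comp (matrixAction u) := by
    refine MvPolynomial.algHom_ext fun p => ?_
    rw [AlgHom.comp_apply, AlgHom.comp_apply, hact]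
    by_cases hp : 1 ≤ p.1.1 ∧ 2 ≤ p.2 ∧ p.2 ≤ κ
    · obtain ⟨a, r, rfl⟩ := exists_eq_slice_index p hp
      have h1 : (⟨a.1 + 1, succ_val_lt a⟩ : Fin n) = j' ↔ a = j := by
        simp [j', Fin.ext_iff]
      simp only [h1]
      rw [map_add, slice_X_succ]
      by_cases h : a = j
      · subst h
        rw [if_pos rfl, map_mul, slice_X_succ, ← algebraMap_eq, AlgHom.commutes]
        simp [shear, algebraMap_eq]
      · rw [if_neg h]
        simp [shear, h]
    · rw [map_add, slice_X_of_not n κ p hp]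
      have h1 : slice n κ (if p.1 = j' then C t * X (i', p.2) else 0) = 0 := by
        split_ifs with h
        · have h2 : ¬ (1 ≤ i'.1 ∧ 2 ≤ p.2 ∧ p.2 ≤ κ) := by
            intro h3
            refine hp ⟨?_, h3.2⟩
            rw [h]
            exact Nat.succ_le_succ (Nat.zero_le _)
          rw [map_mul, slice_X_of_not n κ (i', p.2) h2, if_neg, mul_zero]
          exact fun h3 => Nat.succ_ne_zero _ h3.1
        · exact map_zero _
      rw [h1, add_zero]
      split_ifs <;> simp
  have := DFunLike.congr_fun hcomp P
  rwa [AlgHom.comp_apply, AlgHom.comp_apply, hP u hu] at this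

/-- The values of the variables of the slice at the normal form of the jet of `f`. -/
noncomputable def slicedJet (κ : ℕ) (f : Fin n → Polynomial ℂ) :
    Fin (n - 1) × Fin (κ - 1) → ℂ := fun v =>
  ((Polynomial.derivative (f 0)).eval 0 ^ (2 * v.2.1 + 3))⁻¹ *
    (jetMap f (initialLambda ⟨v.1.1 + 1, succ_val_lt v.1⟩ v.2.1)).eval 0

theorem eval_slice {κ : ℕ} {P : JetRing n} (hP : P ∈ jetPolynomials n κ)
    (f : Fin n → Polynomial ℂ) :
    eval (slicePoint f) P = eval (slicedJet κ f) (slice n κ P) := by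
  have h1 : eval (slicedJet κ f) (slice n κ P) =
      eval (fun p => eval (slicedJet κ f) (slice n κ (X p))) P := by
    have : (aeval (slicedJet κ f) : MvPolynomial _ ℂ →ₐ[ℂ] ℂ).comp (slice n κ) =
        aeval (fun p => eval (slicedJet κ f) (slice n κ (X p))) := by
      refine MvPolynomial.algHom_ext fun p => ?_
      rw [AlgHom.comp_apply, aeval_X]
      rfl
    exact DFunLike.congr_fun this P
  rw [h1]
  refine eval_eq_of_mem_supported hP fun p hp => ?_
  by_cases h : 1 ≤ p.1.1 ∧ 2 ≤ p.2 ∧ p.2 ≤ κ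
  · obtain ⟨i, r, rfl⟩ := exists_eq_slice_index p h
    have h0 : (⟨i.1 + 1, succ_val_lt i⟩ : Fin n) ≠ 0 := fun h' =>
      Nat.succ_ne_zero _ ((Fin.ext_iff.1 h').trans (Fin.val_zero n))
    rw [slice_X_succ, eval_X, slicePoint, slicedJet]
    simp only [if_neg h0, Nat.add_sub_cancel]
    rw [if_neg (show r.1 + 2 ≠ 1 by omega), div_eq_mul_inv, mul_comm]
  · rw [slice_X_of_not n κ p h, slicePoint]
    have hp0 : p.1 = 0 ↔ p.1.1 = 0 := by rw [Fin.ext_iff, Fin.val_zero]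
    obtain ⟨hp1, hp2⟩ := hp
    by_cases h1 : p.1.1 = 0
    · rw [if_pos (hp0.2 h1)]
      by_cases h2 : p.2 = 1 <;> simp [h1, h2]
    · have h2 : p.2 = 1 := by
        by_contra h2
        exact h ⟨Nat.one_le_iff_ne_zero.2 h1, by omega, hp2⟩
      rw [if_neg (fun h' => h1 (hp0.1 h')), if_pos h2,
        if_neg (fun h' : p.1.1 = 0 ∧ p.2 = 1 => h1 h'.1), map_zero]

/-- On the open set `f_1' ≠ 0`, the minors of the slice are quotients of minors of initial
bi-invariants by powers of `f_1'`. -/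
theorem exists_of_mem_flagAlgebra {κ : ℕ} {𝒜 : Subalgebra ℂ (JetRing n)} (hf : f1' n ∈ 𝒜)
    (hinit : ∀ l L, IsInitial κ l L → L ∈ 𝒜) {T : MvPolynomial (Fin (n - 1) × Fin (κ - 1)) ℂ}
    (hT : T ∈ flagAlgebra (n - 1) (κ - 1)) :
    ∃ a, ∃ G ∈ 𝒜, ∀ f : Fin n → Polynomial ℂ, (Polynomial.derivative (f 0)).eval 0 ≠ 0 →
      (Polynomial.derivative (f 0)).eval 0 ^ a * eval (slicedJet κ f) T = (jetMap f G).eval 0 := by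
  have hX : ∀ f : Fin n → Polynomial ℂ, (jetMap f (f1' n)).eval 0 =
      (Polynomial.derivative (f 0)).eval 0 := fun f => by
    rw [f1', jetMap_X, Function.iterate_one]
  induction hT using Algebra.adjoin_induction with
  | mem T hT =>
    obtain ⟨s, hs, r, hr, rfl⟩ := hT
    have hsn : s < n := by
      have := NeZero.pos n
      omega
    refine ⟨∑ a, (2 * (r a).1 + 3), lambdaMinor s hsn fun a => (r a).1,
      lambdaMinor_mem hf hinit s hsn _ (fun a b hab => hr hab)
        (fun a => by have := (r a).2; omega), fun f hf0 => ?_⟩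
    have h1 : eval (slicedJet κ f) (flagMinor s hs r) =
        Matrix.det (Matrix.of fun a b : Fin s =>
          ((Polynomial.derivative (f 0)).eval 0 ^ (2 * (r a).1 + 3))⁻¹ *
            (Matrix.of fun a b : Fin s =>
              (jetMap f (initialLambda ⟨b.1 + 1, by have := b.2; omega⟩ (r a).1)).eval 0) a b) := by
      rw [flagMinor, RingHom.map_det]
      congr 1
      ext a b : 2
      simp [slicedJet]
    have h2 : (jetMap f (lambdaMinor s hsn fun a => (r a).1)).eval 0 =
        Matrix.det (Matrix.of fun a b : Fin s =>
              (jetMap f (initialLambda ⟨b.1 + 1, by have := b.2; omega⟩ (r a).1)).eval 0) := by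
      rw [lambdaMinor, AlgHom.map_det, ← Polynomial.coe_evalRingHom, RingHom.map_det]
      rfl
    rw [h1, Matrix.det_mul_column, ← h2, Finset.prod_inv_distrib, Finset.prod_pow_eq_pow_sum,
      mul_inv_cancel_left₀ (pow_ne_zero _ hf0)]
  | algebraMap c =>
    exact ⟨0, algebraMap ℂ _ c, Subalgebra.algebraMap_mem _ c, fun f _ => by
      rw [AlgHom.commutes, algebraMap_eq, eval_C]
      simp⟩
  | add S T _ _ hS hT =>
    obtain ⟨a, G, hG, h1⟩ := hS
    obtain ⟨b, H, hH, h2⟩ := hT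
    refine ⟨a + b, f1' n ^ b * G + f1' n ^ a * H, add_mem (mul_mem (pow_mem hf _) hG)
      (mul_mem (pow_mem hf _) hH), fun f hf0 => ?_⟩
    rw [map_add, map_add, map_mul, map_mul, map_pow, map_pow, Polynomial.eval_add,
      Polynomial.eval_mul, Polynomial.eval_mul, Polynomial.eval_pow, Polynomial.eval_pow, hX,
      ← h1 f hf0, ← h2 f hf0]
    ring
  | mul S T _ _ hS hT =>
    obtain ⟨a, G, hG, h1⟩ := hS
    obtain ⟨b, H, hH, h2⟩ := hT
    refine ⟨a + b, G * H, mul_mem hG hH, fun f hf0 => ?_⟩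
    rw [map_mul, map_mul, Polynomial.eval_mul, ← h1 f hf0, ← h2 f hf0]
    ring

/-- Up to a power of `f_1'`, every bi-invariant is a polynomial in `f_1'` and the initial
bi-invariants. -/
theorem exists_f1'_pow_mul_mem {κ m : ℕ} {𝒜 : Subalgebra ℂ (JetRing n)} (hf : f1' n ∈ 𝒜)
    (hinit : ∀ l L, IsInitial κ l L → L ∈ 𝒜) {P : JetRing n} (hP : P ∈ UEwt n κ m) :
    ∃ a, f1' n ^ a * P ∈ 𝒜 := by
  obtain ⟨a, G, hG, h⟩ := exists_of_mem_flagAlgebra hf hinit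
    (mem_flagAlgebra_of_shear (P := slice n κ P) fun i j hij t => shear_slice hP.2 hij t)
  refine ⟨a, ?_⟩
  have key : f1' n ^ a * P = f1' n ^ m * G := by
    refine eq_of_forall_jetMap fun f hf0 => ?_
    have hX : (jetMap f (f1' n)).eval 0 = (Polynomial.derivative (f 0)).eval 0 := by
      rw [f1', jetMap_X, Function.iterate_one]
    rw [map_mul, map_mul, map_pow, map_pow, Polynomial.eval_mul, Polynomial.eval_mul,
      Polynomial.eval_pow, Polynomial.eval_pow, hX, ← h f hf0, eval_eq_slicePoint hP f hf0,
      eval_slice hP.1.1]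
    ring
  rw [key]
  exact mul_mem (pow_mem hf _) hG

end Slice

/-! ### Homogeneous components -/

section Components

theorem weightedHomogeneousComponent_mul_of_isWeightedHomogeneous {σ : Type*} {w : σ → ℕ}
    {S : MvPolynomial σ ℂ} {μ : ℕ} (hS : IsWeightedHomogeneous w S μ) (G : MvPolynomial σ ℂ)
    (m : ℕ) : weightedHomogeneousComponent w m (G * S) =
      if μ ≤ m then weightedHomogeneousComponent w (m - μ) G * S else 0 := by
  induction G using MvPolynomial.induction_on' with
  | monomial e c =>
    have h1 : IsWeightedHomogeneous w (monomial e c) (Finsupp.weight w e) :=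
      isWeightedHomogeneous_monomial _ _ _ rfl
    rw [weightedHomogeneousComponent_of_mem (h1.mul hS), weightedHomogeneousComponent_of_mem h1]
    by_cases h : μ ≤ m
    · rw [if_pos h]
      by_cases h2 : m = Finsupp.weight w e + μ
      · rw [if_pos h2, if_pos (by omega)]
      · rw [if_neg h2, if_neg (by omega), zero_mul]
    · rw [if_neg h, if_neg (by omega)]
  | add p q hp hq =>
    rw [add_mul, map_add, hp, hq]
    split_ifs
    · rw [map_add, add_mul]
    · rw [add_zero]

theorem isWeightedHomogeneous_prod_pow {σ τ : Type*} {w : σ → ℕ} {v : τ → ℕ}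
    {g : σ → MvPolynomial τ ℂ} (hg : ∀ s, IsWeightedHomogeneous v (g s) (w s)) (e : σ →₀ ℕ) :
    IsWeightedHomogeneous v (e.prod fun s k => g s ^ k) (Finsupp.weight w e) := by
  rw [Finsupp.weight_apply, Finsupp.sum, Finsupp.prod]
  exact IsWeightedHomogeneous.prod _ _ _ fun s _ => (hg s).pow _

theorem weightedHomogeneousComponent_aeval {σ τ : Type*} {w : σ → ℕ} {v : τ → ℕ}
    {g : σ → MvPolynomial τ ℂ} (hg : ∀ s, IsWeightedHomogeneous v (g s) (w s))
    (H : MvPolynomial σ ℂ) (m : ℕ) : weightedHomogeneousComponent v m (aeval g H) =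
      aeval g (weightedHomogeneousComponent w m H) := by
  induction H using MvPolynomial.induction_on' with
  | monomial e c =>
    have h1 : IsWeightedHomogeneous w (monomial e c) (Finsupp.weight w e) :=
      isWeightedHomogeneous_monomial _ _ _ rfl
    have h2 : IsWeightedHomogeneous v (aeval g (monomial e c)) (Finsupp.weight w e) := by
      rw [aeval_monomial]
      simpa using (isWeightedHomogeneous_C v c).mul (isWeightedHomogeneous_prod_pow hg e)
    rw [weightedHomogeneousComponent_of_mem h1, weightedHomogeneousComponent_of_mem h2]
    split_ifs
    · rfl
    · rw [map_zero]
  | add p q hp hq => simp only [map_add, hp, hq]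

theorem weightedHomogeneousComponent_rename {M : ℕ} (ℓ : Fin M → ℕ) (H : MvPolynomial (Fin M) ℂ)
    (m : ℕ) : weightedHomogeneousComponent (withF1Weight ℓ) m (rename some H) =
      rename some (weightedHomogeneousComponent ℓ m H) := by
  have : (rename some : MvPolynomial (Fin M) ℂ →ₐ[ℂ] MvPolynomial (Option (Fin M)) ℂ) =
      aeval fun j => X (some j) := by
    ext j
    simp
  rw [this]
  exact weightedHomogeneousComponent_aeval
    (fun j => isWeightedHomogeneous_X ℂ (withF1Weight ℓ) (some j)) H m

theorem exists_eq_rename_add_X_mul {M : ℕ} (H : MvPolynomial (Option (Fin M)) ℂ) :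
    ∃ H₀ H₁, H = rename some H₀ + X none * H₁ := by
  induction H using MvPolynomial.induction_on with
  | C a => exact ⟨C a, 0, by simp⟩
  | add p q hp hq =>
    obtain ⟨p₀, p₁, hp⟩ := hp
    obtain ⟨q₀, q₁, hq⟩ := hq
    refine ⟨p₀ + q₀, p₁ + q₁, ?_⟩
    rw [hp, hq, map_add]
    ring
  | mul_X p v hp =>
    obtain ⟨p₀, p₁, hp⟩ := hp
    rcases v with _ | j
    · refine ⟨0, p, ?_⟩
      rw [map_zero]
      ring
    · refine ⟨p₀ * X j, p₁ * X (some j), ?_⟩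
      conv_lhs => rw [hp]
      rw [map_mul, rename_X]
      ring

end Components

/-! ### Generation -/

section Generation

variable {n κ : ℕ} [NeZero n] {M N : ℕ} {Λ : Fin M → JetRing n}

theorem f1'_mem_UEwt (hκ : 1 ≤ κ) : f1' n ∈ UEwt n κ 1 := by
  refine ⟨⟨X_mem_supported.2 ⟨le_rfl, hκ⟩, fun f φ hf hφ h0 _ => ?_⟩, fun u hu => ?_⟩
  · have h1 := (hf 0).differentiableAt
    rw [← h0] at h1
    simp only [f1', eval_X, jetAt, iteratedDeriv_one]
    rw [deriv_comp 0 h1 hφ.differentiableAt, h0, pow_one, mul_comm]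
  · have h0 : ∀ j : Fin n, j ≠ 0 → (0 : Fin n) < j := fun j hj => Fin.pos_iff_ne_zero.2 hj
    rw [f1', matrixAction, aeval_X, Finset.sum_eq_single 0]
    · rw [hu.1, C_1, one_mul]
    · intro j _ hj
      rw [hu.2 0 j (h0 j hj), C_0, zero_mul]
    · simp

theorem pow_mem_UEwt {m : ℕ} {P : JetRing n} (hP : P ∈ UEwt n κ m) (k : ℕ) :
    P ^ k ∈ UEwt n κ (k * m) := by
  induction k with
  | zero => rw [pow_zero, zero_mul]; exact one_mem_UEwt n κ
  | succ k ih =>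
    rw [pow_succ, add_mul, one_mul]
    exact UEwt_mul_le n κ _ _ (Submodule.mul_mem_mul ih hP)

theorem aeval_mem_UEwt {ℓ : Fin M → ℕ} (hΛ : ∀ j, Λ j ∈ UEwt n κ (ℓ j))
    {H : MvPolynomial (Fin M) ℂ} {m : ℕ} (hH : IsWeightedHomogeneous ℓ H m) :
    aeval Λ H ∈ UEwt n κ m := by
  classical
  rw [aeval_def, eval₂_eq]
  refine Submodule.sum_mem _ fun e he => ?_
  rw [← Algebra.smul_def]
  refine Submodule.smul_mem _ _ ?_
  rw [← hH (mem_support_iff.1 he), Finsupp.weight_apply, Finsupp.sum]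
  induction e.support using Finset.induction_on with
  | empty => exact one_mem_UEwt n κ
  | insert j s hj ih =>
    rw [Finset.prod_insert hj, Finset.sum_insert hj]
    exact UEwt_mul_le n κ _ _ (Submodule.mul_mem_mul (pow_mem_UEwt (hΛ j) _) ih)

theorem mem_generated_iff {Q : JetRing n} :
    Q ∈ generated Λ ↔ ∃ H : MvPolynomial (Option (Fin M)) ℂ, aeval (withF1 Λ) H = Q := by
  rw [generated, Algebra.adjoin_range_eq_range_aeval]
  exact AlgHom.mem_range _

theorem aeval_withF1_rename (H : MvPolynomial (Fin M) ℂ) :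
    aeval (withF1 Λ) (rename some H) = aeval Λ H :=
  aeval_rename _ _ _

theorem aeval_withF1_X_none : aeval (withF1 Λ) (X none : MvPolynomial (Option (Fin M)) ℂ) = f1' n :=
  aeval_X _ _

theorem f1'_mem_generated (Λ : Fin M → JetRing n) : f1' n ∈ generated Λ :=
  mem_generated_iff.2 ⟨X none, aeval_withF1_X_none⟩

theorem aeval_mem_generated (H : MvPolynomial (Fin M) ℂ) : aeval Λ H ∈ generated Λ :=
  mem_generated_iff.2 ⟨rename some H, aeval_withF1_rename H⟩

theorem restrict_f1' : restrict n (f1' n) = 0 := by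
  simp [restrict, f1']

theorem mem_idealRel {H : MvPolynomial (Fin M) ℂ} :
    H ∈ idealRel Λ ↔ restrict n (aeval Λ H) = 0 := by
  rw [idealRel, RingHom.mem_ker, ← comp_aeval_apply]

/-- Relations between the restrictions to `f_1' = 0` produce multiples of `f_1'`, and by hypothesis
the quotients are not new. Hence the generated algebra is saturated with respect to `f_1'`. -/
theorem mem_generated_of_f1'_mul {S : Fin N → MvPolynomial (Fin M) ℂ}
    (hS : Ideal.span (Set.range S) = idealRel Λ) {R : Fin N → MvPolynomial (Option (Fin M)) ℂ}
    (hR : ∀ i, aeval Λ (S i) = f1' n * aeval (withF1 Λ) (R i)) {Q : JetRing n}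
    (hQ : f1' n * Q ∈ generated Λ) : Q ∈ generated Λ := by
  obtain ⟨H, hH⟩ := mem_generated_iff.1 hQ
  obtain ⟨H₀, H₁, rfl⟩ := exists_eq_rename_add_X_mul H
  rw [map_add, map_mul, aeval_withF1_rename, aeval_withF1_X_none] at hH
  have h0 : H₀ ∈ Ideal.span (Set.range S) := by
    rw [hS, mem_idealRel]
    have := congrArg (restrict n) hH
    simpa [restrict_f1'] using this
  obtain ⟨c, rfl⟩ := Ideal.mem_span_range_iff_exists_fun.1 h0
  have h1 : aeval Λ (∑ i, c i * S i) = f1' n * ∑ i, aeval Λ (c i) * aeval (withF1 Λ) (R i) := by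
    rw [map_sum, Finset.mul_sum]
    exact Finset.sum_congr rfl fun i _ => by rw [map_mul, hR]; ring
  rw [h1, ← mul_add] at hH
  rw [← mul_left_cancel₀ (X_ne_zero _) hH]
  exact add_mem (Subalgebra.sum_mem _ fun i _ => mul_mem (aeval_mem_generated _)
    (mem_generated_iff.2 ⟨_, rfl⟩)) (mem_generated_iff.2 ⟨_, rfl⟩)

theorem mem_generated_of_f1'_pow_mul {S : Fin N → MvPolynomial (Fin M) ℂ}
    (hS : Ideal.span (Set.range S) = idealRel Λ) {R : Fin N → MvPolynomial (Option (Fin M)) ℂ}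
    (hR : ∀ i, aeval Λ (S i) = f1' n * aeval (withF1 Λ) (R i)) {Q : JetRing n} (a : ℕ)
    (hQ : f1' n ^ a * Q ∈ generated Λ) : Q ∈ generated Λ := by
  induction a with
  | zero => simpa using hQ
  | succ a ih =>
    rw [pow_succ', mul_assoc] at hQ
    exact ih (mem_generated_of_f1'_mul hS hR hQ)

theorem AlgorithmOutput.initial_mem {M : ℕ} {ℓ : Fin M → ℕ} {Λ : Fin M → JetRing n}
    (h : AlgorithmOutput n κ M ℓ Λ) {l : ℕ} {L : JetRing n} (hL : IsInitial κ l L) :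
    L ∈ generated Λ := by
  induction h with
  | init ℓ Λ _ _ complete =>
    obtain ⟨j, -, rfl⟩ := complete l L hL
    exact Algebra.subset_adjoin ⟨some j, rfl⟩
  | @loop M k ℓ Λ ℓ' Λ' _ _ ih =>
    refine Algebra.adjoin_mono ?_ ih
    rintro _ ⟨o, rfl⟩
    rcases o with _ | j
    · exact ⟨none, rfl⟩
    · exact ⟨some (Fin.castAdd k j), Fin.append_left Λ Λ' j⟩
  | prune ℓ Λ e _ redundant ih =>
    refine Algebra.adjoin_le ?_ ih
    rintro _ ⟨o, rfl⟩
    rcases o with _ | j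
    · exact f1'_mem_generated _
    · exact redundant j

/-- The syzygies `S_i(A) - F R_i` are relations between `f_1'` and the `Λ_j`. -/
theorem span_le_ker_aeval {S : Fin N → MvPolynomial (Fin M) ℂ} {R : Fin N → MvPolynomial (Option (Fin M)) ℂ}
    (hR : ∀ i, aeval Λ (S i) = f1' n * aeval (withF1 Λ) (R i)) :
    Ideal.span (Set.range fun i => rename some (S i) - X none * R i) ≤
      RingHom.ker (aeval (withF1 Λ) : MvPolynomial (Option (Fin M)) ℂ →ₐ[ℂ] JetRing n) := by
  rw [Ideal.span_le]
  rintro _ ⟨i, rfl⟩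
  rw [SetLike.mem_coe, RingHom.mem_ker, map_sub, map_mul, aeval_withF1_rename,
    aeval_withF1_X_none, hR, sub_self]

end Generation

/-! ### Normal forms -/

section NormalForm

variable {n κ : ℕ} [NeZero n] {M N : ℕ} {ℓ : Fin M → ℕ} {Λ : Fin M → JetRing n}

theorem normalForm_succ {m : ℕ} (P : Fin (m + 2) → MvPolynomial (Fin M) ℂ) :
    normalForm Λ P = aeval Λ (P 0) + f1' n * normalForm Λ (fun a : Fin (m + 1) => P a.succ) := by
  rw [normalForm, Fin.sum_univ_succ, normalForm, Finset.mul_sum]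
  simp only [Fin.val_zero, pow_zero, one_mul, Fin.val_succ, pow_succ']
  simp only [mul_assoc]

/-- A relation among normal forms is trivial: restricted to `f_1' = 0` it yields an element of the
ideal of relations, none of whose monomials is divisible by a leading monomial of the basis. -/
theorem eq_zero_of_normalForm_eq_zero {ord : MonomialOrder.{0, 0} (Fin M)}
    {S : Fin N → MvPolynomial (Fin M) ℂ}
    (hS : ∀ p ∈ idealRel Λ, p ≠ 0 → ∃ i, ord.degree (S i) ≤ ord.degree p) {m : ℕ}
    {P : Fin (m + 1) → MvPolynomial (Fin M) ℂ}
    (hP : ∀ a, ∀ b ∈ (P a).support, ∀ i, ¬ ord.degree (S i) ≤ b) (h0 : normalForm Λ P = 0) :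
    P = 0 := by
  have hzero : ∀ p : MvPolynomial (Fin M) ℂ,
      (∀ b ∈ p.support, ∀ i, ¬ ord.degree (S i) ≤ b) → p ∈ idealRel Λ → p = 0 := by
    intro p hp hpI
    by_contra hp0
    obtain ⟨i, hi⟩ := hS p hpI hp0
    exact hp _ (ord.degree_mem_support hp0) i hi
  induction m with
  | zero =>
    funext a
    rw [Fin.fin_one_eq_zero a]
    refine hzero _ (hP 0) (mem_idealRel.2 ?_)
    rw [normalForm, Fin.sum_univ_one] at h0
    simp only [Fin.val_zero, pow_zero, one_mul] at h0
    rw [h0, map_zero]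
  | succ m ih =>
    rw [normalForm_succ] at h0
    have h1 : P 0 = 0 := by
      refine hzero _ (hP 0) (mem_idealRel.2 ?_)
      have := congrArg (restrict n) h0
      simpa [restrict_f1'] using this
    rw [h1, map_zero, zero_add] at h0
    have h2 := ih (fun a => hP a.succ) ((mul_eq_zero.1 h0).resolve_left (X_ne_zero _))
    funext a
    refine Fin.cases h1 (fun a => ?_) a
    exact congrFun h2 a

/-- The polynomial in the variables `F, A_1, …, A_M` that represents a normal form. -/
noncomputable def normalPolynomial {m : ℕ} (P : Fin (m + 1) → MvPolynomial (Fin M) ℂ) :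
    MvPolynomial (Option (Fin M)) ℂ :=
  ∑ a : Fin (m + 1), X none ^ a.1 * rename some (P a)

theorem normalPolynomial_succ {m : ℕ} (P : Fin (m + 2) → MvPolynomial (Fin M) ℂ) :
    normalPolynomial P = rename some (P 0) +
      normalPolynomial (fun a : Fin (m + 1) => P a.succ) * X none := by
  rw [normalPolynomial, Fin.sum_univ_succ, normalPolynomial, Finset.sum_mul, Fin.val_zero,
    pow_zero, one_mul]
  refine congrArg (rename some (P 0) + ·) (Finset.sum_congr rfl fun a _ => ?_)
  rw [Fin.val_succ, pow_succ, mul_right_comm]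

theorem aeval_normalPolynomial {m : ℕ} (P : Fin (m + 1) → MvPolynomial (Fin M) ℂ) :
    aeval (withF1 Λ) (normalPolynomial P) = normalForm Λ P := by
  simp only [normalPolynomial, normalForm, map_sum, map_mul, map_pow, aeval_withF1_rename,
    aeval_withF1_X_none]

/-- Normalization: division by the Gröbner basis, followed by the replacement of `S_i` by
`F R_i`, reduces a polynomial of weight `m` to a part without `F` in normal form and to a multiple
of `F`, which is normalized by induction on the weight. -/
theorem exists_normalPolynomial {ord : MonomialOrder.{0, 0} (Fin M)}
    {S : Fin N → MvPolynomial (Fin M) ℂ} (hS0 : ∀ i, S i ≠ 0) {μ : Fin N → ℕ}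
    (hμ : ∀ i, IsWeightedHomogeneous ℓ (S i) (μ i))
    {R : Fin N → MvPolynomial (Option (Fin M)) ℂ}
    (hR : ∀ i, IsWeightedHomogeneous (withF1Weight ℓ) (X none * R i) (μ i)) {m : ℕ}
    {H : MvPolynomial (Option (Fin M)) ℂ} (hH : IsWeightedHomogeneous (withF1Weight ℓ) H m) :
    ∃ P : Fin (m + 1) → MvPolynomial (Fin M) ℂ,
      IsGroebnerNormalized ℓ (fun i => ord.degree (S i)) m P ∧
      H - normalPolynomial P ∈
        Ideal.span (Set.range fun i => rename some (S i) - X none * R i) := by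
  set K := Ideal.span (Set.range fun i => rename some (S i) - X none * R i) with hK
  have hgen : ∀ i, IsWeightedHomogeneous (withF1Weight ℓ) (rename some (S i) - X none * R i)
      (μ i) := by
    intro i
    refine Submodule.sub_mem (weightedHomogeneousSubmodule ℂ (withF1Weight ℓ) (μ i)) ?_ (hR i)
    have := weightedHomogeneousComponent_rename ℓ (S i) (μ i)
    rw [weightedHomogeneousComponent_eq_self (hμ i)] at this
    rw [← this]
    exact weightedHomogeneousComponent_isWeightedHomogeneous _ _
  have hKhom : ∀ x ∈ K, ∀ d, weightedHomogeneousComponent (withF1Weight ℓ) d x ∈ K := by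
    intro x hx d
    obtain ⟨c, rfl⟩ := Ideal.mem_span_range_iff_exists_fun.1 hx
    rw [map_sum]
    refine Ideal.sum_mem _ fun i _ => ?_
    rw [weightedHomogeneousComponent_mul_of_isWeightedHomogeneous (hgen i)]
    split_ifs
    · exact Ideal.mul_mem_left _ _ (Ideal.subset_span ⟨i, rfl⟩)
    · exact zero_mem _
  -- the division step
  have step : ∀ (d : ℕ) (H : MvPolynomial (Option (Fin M)) ℂ),
      IsWeightedHomogeneous (withF1Weight ℓ) H d → ∃ (r : MvPolynomial (Fin M) ℂ)
        (H' : MvPolynomial (Option (Fin M)) ℂ), IsWeightedHomogeneous ℓ r d ∧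
        (∀ b ∈ r.support, ∀ i, ¬ ord.degree (S i) ≤ b) ∧
        H - (rename some r + if 1 ≤ d then
          weightedHomogeneousComponent (withF1Weight ℓ) (d - 1) H' * X none else 0) ∈ K := by
    intro d H hH
    obtain ⟨H₀, H₁, hH01⟩ := exists_eq_rename_add_X_mul H
    obtain ⟨g, r, hgr, -, hr⟩ := MonomialOrder.div (m := ord) (b := S)
      (fun i => (MonomialOrder.leadingCoeff_ne_zero_iff.2 (hS0 i)).isUnit) H₀
    have hmem : H - (rename some r + (H₁ + ∑ i, rename some (g i) * R i) * X none) ∈ K := by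
      have : H - (rename some r + (H₁ + ∑ i, rename some (g i) * R i) * X none) =
          ∑ i, rename some (g i) * (rename some (S i) - X none * R i) := by
        rw [hH01, hgr, Finsupp.linearCombination_apply, Finsupp.sum_fintype _ _ (by simp), map_add,
          map_sum]
        simp only [smul_eq_mul, map_mul, mul_sub, Finset.sum_sub_distrib, add_mul, Finset.sum_mul]
        have : ∀ i, rename some (g i) * (X none * R i) =
            rename some (g i) * R i * X none := fun i => by ring
        simp only [this]
        ring
      rw [this]
      exact Ideal.sum_mem _ fun i _ => Ideal.mul_mem_left _ _ (Ideal.subset_span ⟨i, rfl⟩)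
    refine ⟨weightedHomogeneousComponent ℓ d r, H₁ + ∑ i, rename some (g i) * R i,
      weightedHomogeneousComponent_isWeightedHomogeneous _ _, fun b hb => hr b ?_, ?_⟩
    · rw [mem_support_iff, coeff_weightedHomogeneousComponent] at hb
      rw [mem_support_iff]
      exact fun h => hb (by rw [h, ite_self])
    · have h1 := hKhom _ hmem d
      rw [map_sub, map_add, weightedHomogeneousComponent_eq_self hH,
        weightedHomogeneousComponent_rename,
        weightedHomogeneousComponent_mul_of_isWeightedHomogeneous
          (isWeightedHomogeneous_X ℂ (withF1Weight ℓ) none)] at h1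
      exact h1
  induction m generalizing H with
  | zero =>
    obtain ⟨r, H', hr1, hr2, hr3⟩ := step 0 H hH
    refine ⟨fun _ => r, fun a => ⟨?_, hr2⟩, ?_⟩
    · rwa [Nat.zero_sub]
    · simpa [normalPolynomial] using hr3
  | succ m ih =>
    obtain ⟨r, H', hr1, hr2, hr3⟩ := step (m + 1) H hH
    rw [if_pos (Nat.succ_le_succ (Nat.zero_le m)), Nat.add_sub_cancel] at hr3
    obtain ⟨P, hP1, hP2⟩ := ih
      (weightedHomogeneousComponent_isWeightedHomogeneous (w := withF1Weight ℓ) m H')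
    let Q : Fin (m + 2) → MvPolynomial (Fin M) ℂ := Fin.cons r P
    have hQ0 : Q 0 = r := rfl
    have hQs : ∀ a : Fin (m + 1), Q a.succ = P a := fun a => rfl
    refine ⟨Q, fun a => ?_, ?_⟩
    · rcases Fin.eq_zero_or_eq_succ a with rfl | ⟨a, rfl⟩
      · exact ⟨hr1, hr2⟩
      · rw [hQs, Fin.val_succ, Nat.succ_sub_succ]
        exact hP1 a
    · have h1 : normalPolynomial Q = rename some r + normalPolynomial P * X none := by
        rw [normalPolynomial_succ]
        rfl
      have h2 := add_mem hr3 (Ideal.mul_mem_right (X none) _ hP2)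
      rw [h1]
      refine (congrArg (· ∈ K) ?_).mp h2
      generalize weightedHomogeneousComponent (withF1Weight ℓ) m H' = H''
      ring

end NormalForm

end BiInvariant

theorem mainTheorem4 {n κ : ℕ} [NeZero n] (hκ : 1 ≤ κ)
    -- bi-invariants `f_1', Λ_1, …, Λ_M` obtained after finitely many loops
    {M : ℕ} (ℓ : Fin M → ℕ) (Λ : Fin M → JetRing n)
    (hout : AlgorithmOutput n κ M ℓ Λ)
    (hΛ : ∀ j, Λ j ∈ UEwt n κ (ℓ j))
    (hind : MutuallyIndependent (withF1 Λ))
    -- a reduced Gröbner basis, homogeneous, of the relations between the restrictions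
    (ord : MonomialOrder.{0, 0} (Fin M)) {N : ℕ} (S : Fin N → MvPolynomial (Fin M) ℂ)
    (hS : IsReducedGroebnerBasis ord (idealRel Λ) S)
    (μ : Fin N → ℕ) (hμ : ∀ i, IsWeightedHomogeneous ℓ (S i) (μ i))
    -- no new bi-invariant appears behind `f_1'`
    (R : Fin N → MvPolynomial (Option (Fin M)) ℂ)
    (hR : ∀ i, aeval Λ (S i) = f1' n * aeval (withF1 Λ) (R i)) :
    -- the algorithm terminates
    (∀ (k : ℕ) (ℓ' : Fin k → ℕ) (Λ' : Fin k → JetRing n), IsLoop ℓ Λ ℓ' Λ' → k = 0) ∧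
    -- generation
    UE n κ = generated Λ ∧
    -- the ideal of all relations is generated by the syzygies
    (∃ R' : Fin N → MvPolynomial (Option (Fin M)) ℂ, ∀ i,
      IsWeightedHomogeneous (withF1Weight ℓ) (X none * R' i) (μ i) ∧
      aeval Λ (S i) = f1' n * aeval (withF1 Λ) (R' i)) ∧
    (∀ R' : Fin N → MvPolynomial (Option (Fin M)) ℂ,
      (∀ i, IsWeightedHomogeneous (withF1Weight ℓ) (X none * R' i) (μ i) ∧
        aeval Λ (S i) = f1' n * aeval (withF1 Λ) (R' i)) →
      RingHom.ker (aeval (withF1 Λ) : MvPolynomial (Option (Fin M)) ℂ →ₐ[ℂ] JetRing n) =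
        Ideal.span (Set.range fun i => rename some (S i) - X none * R' i)) ∧
    -- the normal form
    ∀ m : ℕ,
      (∀ P : Fin (m + 1) → MvPolynomial (Fin M) ℂ,
        IsGroebnerNormalized ℓ (fun i => ord.degree (S i)) m P → normalForm Λ P ∈ UEwt n κ m) ∧
      ∀ Q ∈ UEwt n κ m, ∃! P : Fin (m + 1) → MvPolynomial (Fin M) ℂ,
        IsGroebnerNormalized ℓ (fun i => ord.degree (S i)) m P ∧ Q = normalForm Λ P := by
  have hgen_mem : ∀ o, withF1 Λ o ∈ UEwt n κ (withF1Weight ℓ o) := by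
    rintro (_ | j)
    · exact f1'_mem_UEwt hκ
    · exact hΛ j
  have hhom : ∀ o, IsWeightedHomogeneous Prod.snd (withF1 Λ o) (withF1Weight ℓ o) := fun o =>
    isWeightedHomogeneous_of_mem_UEwt (hgen_mem o)
  have hgen : UE n κ = generated Λ := by
    refine le_antisymm (fun P hP => ?_) (Algebra.adjoin_le ?_)
    · have hle : (⨆ m, UEwt n κ m) ≤ Subalgebra.toSubmodule (generated Λ) := by
        refine iSup_le fun m Q hQ => ?_
        obtain ⟨a, ha⟩ := exists_f1'_pow_mul_mem (f1'_mem_generated Λ)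
          (fun _ _ hL => hout.initial_mem hL) hQ
        exact mem_generated_of_f1'_pow_mul hS.span_eq hR a ha
      exact hle hP
    · rintro _ ⟨o, rfl⟩
      exact Submodule.mem_iSup_of_mem _ (hgen_mem o)
  obtain ⟨R₀, hR₀⟩ : ∃ R' : Fin N → MvPolynomial (Option (Fin M)) ℂ, ∀ i,
      IsWeightedHomogeneous (withF1Weight ℓ) (X none * R' i) (μ i) ∧
      aeval Λ (S i) = f1' n * aeval (withF1 Λ) (R' i) := by
    -- the component of weight `μ i` of `F R_i` is again a multiple of `F`
    have h : ∀ i, ∃ R', X none * R' =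
        weightedHomogeneousComponent (withF1Weight ℓ) (μ i) (X none * R i) := by
      intro i
      rw [mul_comm, weightedHomogeneousComponent_mul_of_isWeightedHomogeneous
        (isWeightedHomogeneous_X ℂ (withF1Weight ℓ) none)]
      split_ifs
      · exact ⟨_, mul_comm _ _⟩
      · exact ⟨0, mul_zero _⟩
    choose R' hR' using h
    refine ⟨R', fun i => ⟨?_, ?_⟩⟩
    · rw [hR']
      exact weightedHomogeneousComponent_isWeightedHomogeneous _ _
    · have h1 : IsWeightedHomogeneous Prod.snd (aeval Λ (S i)) (μ i) :=
        isWeightedHomogeneous_of_mem_UEwt (aeval_mem_UEwt hΛ (hμ i))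
      rw [← aeval_withF1_X_none, ← map_mul, hR', ← weightedHomogeneousComponent_aeval hhom,
        map_mul, aeval_withF1_X_none, ← hR, weightedHomogeneousComponent_eq_self h1]
  have hnormal : ∀ {m : ℕ} {P : Fin (m + 1) → MvPolynomial (Fin M) ℂ},
      IsGroebnerNormalized ℓ (fun i => ord.degree (S i)) m P → normalForm Λ P = 0 → P = 0 :=
    fun hP h0 => eq_zero_of_normalForm_eq_zero hS.leading (fun a => (hP a).2) h0
  refine ⟨fun k ℓ' Λ' hloop => ?_, hgen, ⟨R₀, hR₀⟩, fun R' hR' => ?_, fun m => ⟨fun P hP => ?_,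
    fun Q hQ => ?_⟩⟩
  · by_contra hk
    obtain ⟨_, _, S', _, _, _, hrem, hnew, _⟩ := hloop
    let j : Fin k := ⟨0, Nat.pos_of_ne_zero hk⟩
    obtain ⟨i, ν, ⟨hfac, -⟩, -⟩ := hrem j
    refine hnew j (Algebra.adjoin_mono Set.subset_union_left ?_)
    refine mem_generated_of_f1'_pow_mul hS.span_eq hR ν ?_
    rw [← hfac]
    exact aeval_mem_generated _
  · have hle := span_le_ker_aeval fun i => (hR' i).2
    refine le_antisymm (fun H hH => ?_) hle
    rw [RingHom.mem_ker] at hH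
    -- the ideal of relations is homogeneous
    rw [← sum_weightedHomogeneousComponent (withF1Weight ℓ) H]
    refine finsum_induction
      (· ∈ Ideal.span (Set.range fun i => rename some (S i) - X none * R' i)) (zero_mem _)
      (fun _ _ => add_mem) fun m => ?_
    obtain ⟨P, hP, hmem⟩ := exists_normalPolynomial (ord := ord) hS.ne_zero hμ
      (fun i => (hR' i).1)
      (weightedHomogeneousComponent_isWeightedHomogeneous (w := withF1Weight ℓ) m H)
    have h0 : normalForm Λ P = 0 := by
      have h1 := hle hmem
      rw [RingHom.mem_ker, map_sub, ← weightedHomogeneousComponent_aeval hhom, hH, map_zero,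
        zero_sub, neg_eq_zero, aeval_normalPolynomial] at h1
      exact h1
    rw [hnormal hP h0] at hmem
    simpa [normalPolynomial] using hmem
  · refine Submodule.sum_mem _ fun a _ => ?_
    have h1 := UEwt_mul_le n κ _ _ (Submodule.mul_mem_mul (pow_mem_UEwt (f1'_mem_UEwt hκ) a.1)
      (aeval_mem_UEwt hΛ (hP a).1))
    rwa [mul_one, Nat.add_sub_cancel' (Nat.lt_succ_iff.1 a.2)] at h1
  · have hQ' : Q ∈ generated Λ := hgen ▸ Submodule.mem_iSup_of_mem m hQ
    obtain ⟨H, rfl⟩ := mem_generated_iff.1 hQ'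
    obtain ⟨P, hP, hmem⟩ := exists_normalPolynomial (ord := ord) hS.ne_zero hμ
      (fun i => (hR₀ i).1)
      (weightedHomogeneousComponent_isWeightedHomogeneous (w := withF1Weight ℓ) m H)
    have hform : aeval (withF1 Λ) H = normalForm Λ P := by
      have h1 := span_le_ker_aeval (fun i => (hR₀ i).2) hmem
      rw [RingHom.mem_ker, map_sub, ← weightedHomogeneousComponent_aeval hhom,
        weightedHomogeneousComponent_eq_self (isWeightedHomogeneous_of_mem_UEwt hQ),
        aeval_normalPolynomial, sub_eq_zero] at h1
      exact h1
    refine ⟨P, ⟨hP, hform⟩, fun P' hP' => sub_eq_zero.1 (hnormal (m := m) ?_ ?_)⟩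
    · intro a
      refine ⟨(hP'.1 a).1.sub (hP a).1, fun b hb => ?_⟩
      rcases Finset.mem_union.1 (support_sub _ _ _ hb) with h | h
      · exact (hP'.1 a).2 b h
      · exact (hP a).2 b h
    · have h1 : normalForm Λ (P' - P) = normalForm Λ P' - normalForm Λ P := by
        simp only [normalForm, Pi.sub_apply, map_sub, mul_sub, Finset.sum_sub_distrib]
      rw [h1, ← hP'.2, ← hform, sub_self]
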